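/- Let $G$ be a locally compact Hausdorff étale groupoid (product and inversion are continuous, and the open bisections, i.e. open sets on which both the range map $r$ and the domain map $d$ are homeomorphisms onto open subsets of $G$, form a basis of the topology), with unit space $G^{(0)}$. For $u \in G^{(0)}$ let $G_u = d^{-1}(u)$, $G^u = r^{-1}(u)$, and let $C_r^*(G)$ be the completion of the convolution algebra $C_c(G)$ in the norm $\|f\|_r = \sup_{u} \|\pi_u(f)\|$, where $\pi_u(f)\xi = f * \xi$ on $\ell^2(G_u)$. A set $D \subseteq G^{(0)}$ is invariant if $d(g) \in D$ implies $r(g) \in D$; then $G_D = d^{-1}(D)$. We say: * $G$ is essentially principal if for every closed invariant $D \subseteq G^{(0)}$ the units $u \in D$ with trivial isotropy group $G_u \cap G^u = \{u\}$ are dense in $D$; * $G$ is inner exact if for every closed invariant $D \subseteq G^{(0)}$ the canonical sequence $0 \to C_r^*(G_{G^{(0)} \setminus D}) \to C_r^*(G) \to C_r^*(G_D) \to 0$, given by extension by zero and by restriction of functions, is exact; * $C_0(G^{(0)})$ separates the ideals of $C_r^*(G)$ if the map $I \mapsto U_I = \bigcup_{f \in I \cap C_0(G^{(0)})} \{u :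 f(u) \neq 0\}$, from closed two-sided ideals of $C_r^*(G)$ to open invariant subsets of $G^{(0)}$, is injective; * $G$ is amenable if for every compact $K \subseteq G$ and $\varepsilon > 0$ there is a nonnegative $f \in C_c(G)$ with $\bigl|\sum_{h \in G^{r(g)}} f(h) - 1\bigr| < \varepsilon$ and $\sum_{h \in G^{r(g)}} |f(g^{-1}h) - f(h)| < \varepsilon$ for all $g \in K$. Then: 1. If $G$ is essentially principal and inner exact, then $C_0(G^{(0)})$ separates the ideals of $C_r^*(G)$. 2. Suppose $G$ is amenable. If $G$ is essentially principal, then $C_0(G^{(0)})$ separates the ideals of $C_r^*(G)$. Conversely, if $G$ is $\sigma$-compact (for instance, second countable) and $C_0(G^{(0)})$ separates the ideals of $C_r^*(G)$, then $G$ is essentially principal. -/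

import Mathlib

open scoped CompactlySupported ZeroAtInfty ENNReal

/-- A groupoid, presented by its set of arrows `G`: a relation `Composable` (the set of composable
pairs), a product and an inversion. The value of `g * h` is meaningful only for composable pairs;
no axiom and no definition below refers to it elsewhere. -/
class ArrowGroupoid (G : Type*) extends Mul G, Inv G where
  Composable : G → G → Prop
  comp_assoc : ∀ {a b c : G}, Composable a b → Composable b c →
    Composable (a * b) c ∧ Composable a (b * c) ∧ (a * b) * c = a * (b * c)
  comp_inv : ∀ g : G, Composable g g⁻¹
  inv_comp_cancel : ∀ {g h : G}, Composable g h → Composable g⁻¹ (g * h) ∧ g⁻¹ * (g * h) = h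
  comp_inv_cancel : ∀ {g h : G}, Composable g h → Composable (g * h) h⁻¹ ∧ (g * h) * h⁻¹ = g

namespace ArrowGroupoid

section Algebra

variable {G : Type*} [ArrowGroupoid G]

theorem inv_invol (g : G) : (g⁻¹)⁻¹ = g := by
  have h1 := inv_comp_cancel (comp_inv g)
  have h2 := inv_comp_cancel h1.1
  rw [h1.2] at h2
  have h3 := comp_inv_cancel h2.1
  have h4 := comp_inv_cancel (comp_inv g)
  have h5 := inv_comp_cancel (comp_inv (g⁻¹))
  rw [h2.2] at h3
  exact h3.2.symm.trans h4.2

theorem inv_comp (g : G) : Composable g⁻¹ g := by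
  have := comp_inv (g⁻¹)
  rwa [inv_invol] at this

/-- The unit space `G⁽⁰⁾ = {g g⁻¹ | g ∈ G}`. -/
def UnitSpace (G : Type*) [ArrowGroupoid G] : Type _ := {u : G // ∃ g : G, u = g * g⁻¹}

/-- The inclusion of the unit space into the set of arrows. -/
def UnitSpace.arrow (u : UnitSpace G) : G := u.1

/-- The range map `r(g) = g g⁻¹`. -/
def rng (g : G) : UnitSpace G := ⟨g * g⁻¹, g, rfl⟩

/-- The domain map `d(g) = g⁻¹ g`. -/
def dom (g : G) : UnitSpace G := ⟨g⁻¹ * g, g⁻¹, by rw [inv_invol]⟩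

theorem UnitSpace.arrow_injective : Function.Injective (UnitSpace.arrow (G := G)) :=
  Subtype.val_injective

theorem rng_arrow (g : G) : (rng g).arrow = g * g⁻¹ := rfl

theorem dom_arrow (g : G) : (dom g).arrow = g⁻¹ * g := rfl

theorem composable_iff (g h : G) : Composable g h ↔ dom g = rng h := by
  constructor
  · intro H
    apply UnitSpace.arrow_injective
    rw [rng_arrow, dom_arrow]
    have h1 := comp_assoc (inv_comp g) H
    have h2 := comp_inv_cancel h1.1
    rw [h1.2.2, (inv_comp_cancel H).2] at h2
    exact h2.2.symm
  · intro H
    have H' : g⁻¹ * g = h * h⁻¹ := congrArg UnitSpace.arrow H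
    have h1 := comp_assoc (comp_inv g) (inv_comp g)
    have h2 := comp_assoc (comp_inv h) (inv_comp h)
    have h3 := comp_inv_cancel (comp_inv h)
    rw [inv_invol] at h3
    have h4 := h1.2.1
    rw [H'] at h4
    have h5 := comp_assoc h4 h3.1
    rw [h3.2] at h5
    exact h5.2.1

theorem dom_inv (g : G) : dom g⁻¹ = rng g :=
  (composable_iff _ _).1 (inv_comp g)

theorem rng_inv (g : G) : rng g⁻¹ = dom g :=
  ((composable_iff _ _).1 (comp_inv g)).symm

theorem dom_mul {g h : G} (H : Composable g h) : dom (g * h) = dom h := by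
  rw [(composable_iff _ _).1 (comp_inv_cancel H).1, rng_inv]

theorem rng_mul {g h : G} (H : Composable g h) : rng (g * h) = rng g := by
  rw [← (composable_iff _ _).1 (inv_comp_cancel H).1, dom_inv]

theorem rng_unit (u : UnitSpace G) : rng u.arrow = u := by
  obtain ⟨_, g, rfl⟩ := u
  exact rng_mul (comp_inv g)

theorem dom_unit (u : UnitSpace G) : dom u.arrow = u := by
  obtain ⟨_, g, rfl⟩ := u
  exact (dom_mul (comp_inv g)).trans (dom_inv g)

theorem composable_of_rng_eq {g h : G} (H : rng h = rng g) : Composable h⁻¹ g :=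
  (composable_iff _ _).2 ((dom_inv h).trans H)

/-- The pairs `(g, h)` with `r(h) = r(g)` correspond to the pairs `(k, h)` with `d(h) = r(k)`
through `k = h⁻¹ g`. -/
def fibreEquiv (G : Type*) [ArrowGroupoid G] :
    (Σ g : G, {h : G // rng h = rng g}) ≃ (Σ k : G, {h : G // dom h = rng k}) where
  toFun p := ⟨p.2.1⁻¹ * p.1, p.2.1, by
    rw [rng_mul (composable_of_rng_eq p.2.2), rng_inv]⟩
  invFun q := ⟨q.2.1 * q.1, q.2.1, by rw [rng_mul ((composable_iff _ _).2 q.2.2)]⟩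
  left_inv := by
    rintro ⟨g, h, hh⟩
    have h1 := (inv_comp_cancel (composable_of_rng_eq hh)).2
    rw [inv_invol] at h1
    exact Sigma.subtype_ext h1 rfl
  right_inv := by
    rintro ⟨k, h, hh⟩
    have h1 := (inv_comp_cancel ((composable_iff _ _).2 hh)).2
    exact Sigma.subtype_ext h1 rfl

theorem unit_mul (g : G) : (rng g).arrow⁻¹ * g = g := by
  have h1 := comp_inv_cancel (comp_inv g)
  have h2 : (g * g⁻¹) * g = g := by simpa only [inv_invol] using h1.2
  have h3 : Composable (g * g⁻¹) g := by simpa only [inv_invol] using h1.1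
  have h4 := (inv_comp_cancel h3).2
  rw [h2] at h4
  exact h4

/-- A set `D` of units is invariant if `d(g) ∈ D` implies `r(g) ∈ D`. -/
def IsInvariant (D : Set (UnitSpace G)) : Prop := ∀ g : G, dom g ∈ D → rng g ∈ D

theorem IsInvariant.dom_mem {D : Set (UnitSpace G)} (hD : IsInvariant D) {g : G}
    (hg : rng g ∈ D) : dom g ∈ D := by
  have := hD g⁻¹
  rw [dom_inv, rng_inv] at this
  exact this hg

theorem IsInvariant.compl {D : Set (UnitSpace G)} (hD : IsInvariant D) : IsInvariant Dᶜ :=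
  fun _ hg hr => hg (hD.dom_mem hr)

/-- The arrows with domain and range in `D`. For invariant `D`, the only case used below, this is
`{g | d(g) ∈ D}`. -/
def Restr (D : Set (UnitSpace G)) : Type _ := {g : G // dom g ∈ D ∧ rng g ∈ D}

/-- The inclusion of the restricted groupoid. -/
def Restr.incl {D : Set (UnitSpace G)} (g : Restr D) : G := g.1

theorem Restr.incl_injective {D : Set (UnitSpace G)} :
    Function.Injective (Restr.incl (D := D)) := Subtype.val_injective

/-- The element of the restricted groupoid given by an arrow with both ends in `D`. -/
def Restr.of {D : Set (UnitSpace G)} (g : G) (hd : dom g ∈ D) (hr : rng g ∈ D) : Restr D :=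
  ⟨g, hd, hr⟩

theorem Restr.incl_of {D : Set (UnitSpace G)} (g : G) (hd : dom g ∈ D) (hr : rng g ∈ D) :
    (Restr.of g hd hr).incl = g := rfl

open Classical in
/-- The product of `G`, restricted; for a pair that is not composable the value is arbitrary. -/
noncomputable def Restr.mul {D : Set (UnitSpace G)} (g h : Restr D) : Restr D :=
  if H : Composable g.incl h.incl then
    Restr.of (g.incl * h.incl) (by rw [dom_mul H]; exact h.2.1) (by rw [rng_mul H]; exact g.2.2)
  else g

theorem Restr.incl_mul_aux {D : Set (UnitSpace G)} {g h : Restr D}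
    (H : Composable g.incl h.incl) : (Restr.mul g h).incl = g.incl * h.incl := by
  rw [Restr.mul, dif_pos H]; rfl

/-- The inversion of `G`, restricted. -/
def Restr.inv {D : Set (UnitSpace G)} (g : Restr D) : Restr D :=
  Restr.of g.incl⁻¹ (by rw [dom_inv]; exact g.2.2) (by rw [rng_inv]; exact g.2.1)

theorem Restr.incl_inv_aux {D : Set (UnitSpace G)} (g : Restr D) :
    (Restr.inv g).incl = g.incl⁻¹ := rfl

noncomputable instance Restr.instArrowGroupoid (D : Set (UnitSpace G)) :
    ArrowGroupoid (Restr D) where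
  mul := Restr.mul
  inv := Restr.inv
  Composable g h := Composable g.incl h.incl
  comp_assoc := by
    intro a b c hab hbc
    have := comp_assoc hab hbc
    change Composable (Restr.mul a b).incl c.incl ∧ Composable a.incl (Restr.mul b c).incl ∧
      Restr.mul (Restr.mul a b) c = Restr.mul a (Restr.mul b c)
    have h1 : Composable (Restr.mul a b).incl c.incl := by
      rw [Restr.incl_mul_aux hab]; exact this.1
    have h2 : Composable a.incl (Restr.mul b c).incl := by
      rw [Restr.incl_mul_aux hbc]; exact this.2.1
    refine ⟨h1, h2, Restr.incl_injective ?_⟩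
    rw [Restr.incl_mul_aux h1, Restr.incl_mul_aux h2, Restr.incl_mul_aux hab,
      Restr.incl_mul_aux hbc, this.2.2]
  comp_inv := fun g => comp_inv g.incl
  inv_comp_cancel := by
    intro a b hab
    have := inv_comp_cancel hab
    change Composable (Restr.inv a).incl (Restr.mul a b).incl ∧
      Restr.mul (Restr.inv a) (Restr.mul a b) = b
    have h1 : Composable (Restr.inv a).incl (Restr.mul a b).incl := by
      rw [Restr.incl_mul_aux hab]; exact this.1
    refine ⟨h1, Restr.incl_injective ?_⟩
    rw [Restr.incl_mul_aux h1, Restr.incl_mul_aux hab]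
    exact this.2
  comp_inv_cancel := by
    intro a b hab
    have := comp_inv_cancel hab
    change Composable (Restr.mul a b).incl (Restr.inv b).incl ∧
      Restr.mul (Restr.mul a b) (Restr.inv b) = a
    have h1 : Composable (Restr.mul a b).incl (Restr.inv b).incl := by
      rw [Restr.incl_mul_aux hab]; exact this.1
    refine ⟨h1, Restr.incl_injective ?_⟩
    rw [Restr.incl_mul_aux h1, Restr.incl_mul_aux hab]
    exact this.2

theorem Restr.incl_mul {D : Set (UnitSpace G)} {g h : Restr D} (H : Composable g h) :
    (g * h).incl = g.incl * h.incl := Restr.incl_mul_aux H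

theorem Restr.incl_inv {D : Set (UnitSpace G)} (g : Restr D) : (g⁻¹).incl = (g.incl)⁻¹ := rfl

theorem Restr.incl_rng {D : Set (UnitSpace G)} (g : Restr D) :
    (rng g).arrow.incl = (rng g.incl).arrow := by
  rw [rng_arrow, Restr.incl_mul (comp_inv g)]; rfl

theorem Restr.incl_dom {D : Set (UnitSpace G)} (g : Restr D) :
    (dom g).arrow.incl = (dom g.incl).arrow := by
  rw [dom_arrow, Restr.incl_mul (inv_comp g)]; rfl

end Algebra

section Topology

variable {G : Type*} [TopologicalSpace G] [ArrowGroupoid G]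

instance : TopologicalSpace (UnitSpace G) := instTopologicalSpaceSubtype

instance (D : Set (UnitSpace G)) : TopologicalSpace (Restr D) := instTopologicalSpaceSubtype

/-- A bisection: range and domain map restrict to homeomorphisms of `S` onto open subsets
of `G`. -/
def IsBisection (S : Set G) : Prop :=
  Topology.IsOpenEmbedding (fun g : S => (rng (g : G)).arrow) ∧
    Topology.IsOpenEmbedding (fun g : S => (dom (g : G)).arrow)

/-- Étale (locally compact Hausdorff) groupoids: product and inversion are continuous and the open
bisections form a basis of the topology. -/
class IsEtale (G : Type*) [TopologicalSpace G] [ArrowGroupoid G] : Prop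
    extends T2Space G, LocallyCompactSpace G where
  continuousOn_mul : ContinuousOn (fun p : G × G => p.1 * p.2) {p | Composable p.1 p.2}
  continuous_inv : Continuous (fun g : G => g⁻¹)
  isTopologicalBasis : TopologicalSpace.IsTopologicalBasis {S : Set G | IsOpen S ∧ IsBisection S}

theorem continuous_rng [IsEtale G] : Continuous (rng : G → UnitSpace G) := by
  refine Continuous.subtype_mk ?_ _
  have h : Continuous (fun g : G => (g, g⁻¹)) := continuous_id.prodMk IsEtale.continuous_inv
  exact IsEtale.continuousOn_mul.comp_continuous h comp_inv

theorem continuous_dom [IsEtale G] : Continuous (dom : G → UnitSpace G) := by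
  refine Continuous.subtype_mk ?_ _
  have h : Continuous (fun g : G => (g⁻¹, g)) := IsEtale.continuous_inv.prodMk continuous_id
  exact IsEtale.continuousOn_mul.comp_continuous h inv_comp

theorem continuous_incl (D : Set (UnitSpace G)) : Continuous (Restr.incl (D := D)) :=
  continuous_subtype_val

theorem continuous_arrow : Continuous (UnitSpace.arrow (G := G)) := continuous_subtype_val

theorem isInducing_incl (D : Set (UnitSpace G)) :
    Topology.IsInducing (Restr.incl (D := D)) := Topology.IsInducing.subtypeVal

theorem isClosedEmbedding_incl [IsEtale G] {D : Set (UnitSpace G)} (hD : IsClosed D) :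
    Topology.IsClosedEmbedding (Restr.incl (D := D)) :=
  IsClosed.isClosedEmbedding_subtypeVal
    ((hD.preimage continuous_dom).inter (hD.preimage continuous_rng))

theorem isOpenEmbedding_incl [IsEtale G] {D : Set (UnitSpace G)} (hD : IsOpen D) :
    Topology.IsOpenEmbedding (Restr.incl (D := D)) :=
  IsOpen.isOpenEmbedding_subtypeVal
    ((hD.preimage continuous_dom).inter (hD.preimage continuous_rng))

/-- If a map `p` on `G` restricts to an open embedding on a set `S`, and `q` is the
corresponding map on the restriction, then `q` restricts to an open embedding on the trace
of `S`. -/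
theorem restr_openEmbedding {D : Set (UnitSpace G)} {S : Set G} (p : G → G)
    (q : Restr D → Restr D) (hq : Continuous q) (hpq : ∀ g, (q g).incl = p g.incl)
    (hmem : ∀ g : G, (∃ v : Restr D, v.incl = p g) → dom g ∈ D ∧ rng g ∈ D)
    (hp : Topology.IsOpenEmbedding (fun g : S => p g)) :
    Topology.IsOpenEmbedding (fun g : (Restr.incl ⁻¹' S : Set (Restr D)) => q g) := by
  refine Topology.IsOpenEmbedding.of_continuous_injective_isOpenMap
    (hq.comp continuous_subtype_val) ?_ ?_
  · intro a b hab
    have h1 : p a.1.incl = p b.1.incl := by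
      rw [← hpq, ← hpq]; exact congrArg Restr.incl hab
    have h2 := @hp.injective ⟨a.1.incl, a.2⟩ ⟨b.1.incl, b.2⟩ h1
    exact Subtype.ext (Restr.incl_injective (congrArg (fun z : S => (z : G)) h2))
  · intro V hV
    obtain ⟨V₁, hV₁, rfl⟩ := isOpen_induced_iff.1 hV
    obtain ⟨W, hW, rfl⟩ := isOpen_induced_iff.1 hV₁
    have hopen := hp.isOpenMap _ (hW.preimage continuous_subtype_val)
    have key : (fun g : (Restr.incl ⁻¹' S : Set (Restr D)) => q g) ''
        (Subtype.val ⁻¹' (Subtype.val ⁻¹' W)) =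
        Restr.incl ⁻¹' ((fun g : S => p g) '' (Subtype.val ⁻¹' W)) := by
      ext v
      constructor
      · rintro ⟨g, hg, rfl⟩
        exact ⟨⟨g.1.incl, g.2⟩, hg, (hpq _).symm⟩
      · rintro ⟨g, hg, hgv⟩
        refine ⟨⟨⟨g.1, hmem g.1 ⟨v, hgv.symm⟩⟩, g.2⟩, hg, ?_⟩
        apply Restr.incl_injective
        rw [hpq]
        exact hgv
    rw [key]
    exact hopen.preimage (continuous_incl D)

theorem isEtale_restr [IsEtale G] {D : Set (UnitSpace G)} (hD : IsInvariant D)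
    (h : IsClosed D ∨ IsOpen D) : IsEtale (Restr D) := by
  have hinv : Continuous (fun g : Restr D => g⁻¹) :=
    (isInducing_incl D).continuous_iff.2 (IsEtale.continuous_inv.comp (continuous_incl D))
  have hmul : ContinuousOn (fun p : Restr D × Restr D => p.1 * p.2)
      {p | Composable p.1 p.2} := by
    rw [(isInducing_incl D).continuousOn_iff]
    have h1 : ContinuousOn (fun p : Restr D × Restr D => p.1.incl * p.2.incl)
        {p | Composable p.1 p.2} :=
      IsEtale.continuousOn_mul.comp
        (((continuous_incl D).comp continuous_fst).prodMk
          ((continuous_incl D).comp continuous_snd)).continuousOn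
        (fun p hp => hp)
    exact h1.congr fun p hp => Restr.incl_mul hp
  have hr : Continuous (fun g : Restr D => (rng g).arrow) := by
    rw [(isInducing_incl D).continuous_iff]
    exact (continuous_arrow.comp (continuous_rng.comp (continuous_incl D))).congr
      fun g => (Restr.incl_rng g).symm
  have hd : Continuous (fun g : Restr D => (dom g).arrow) := by
    rw [(isInducing_incl D).continuous_iff]
    exact (continuous_arrow.comp (continuous_dom.comp (continuous_incl D))).congr
      fun g => (Restr.incl_dom g).symm
  have hbis : ∀ S : Set G, IsBisection S →
      IsBisection (Restr.incl ⁻¹' S : Set (Restr D)) := by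
    intro S hb
    constructor
    · refine restr_openEmbedding (fun g => (rng g).arrow) (fun g => (rng g).arrow) hr
        Restr.incl_rng ?_ hb.1
      rintro g ⟨v, hv⟩
      have : rng g ∈ D := by
        have h2 := v.2.2
        rwa [show v.1 = (rng g).arrow from hv, rng_unit] at h2
      exact ⟨hD.dom_mem this, this⟩
    · refine restr_openEmbedding (fun g => (dom g).arrow) (fun g => (dom g).arrow) hd
        Restr.incl_dom ?_ hb.2
      rintro g ⟨v, hv⟩
      have : dom g ∈ D := by
        have h2 := v.2.1
        rwa [show v.1 = (dom g).arrow from hv, dom_unit] at h2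
      exact ⟨this, hD g this⟩
  have hT2 : T2Space (Restr D) := inferInstanceAs (T2Space {g : G // dom g ∈ D ∧ rng g ∈ D})
  have hLC : LocallyCompactSpace (Restr D) := by
    rcases h with h | h
    · exact (isClosedEmbedding_incl h).locallyCompactSpace
    · exact (isOpenEmbedding_incl h).locallyCompactSpace
  refine { continuousOn_mul := hmul, continuous_inv := hinv, isTopologicalBasis := ?_ }
  refine TopologicalSpace.isTopologicalBasis_of_isOpen_of_nhds (fun S hS => hS.1) ?_
  intro a V ha hV
  obtain ⟨W, hW, rfl⟩ := isOpen_induced_iff.1 hV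
  obtain ⟨S, hS, haS, hSW⟩ :=
    (IsEtale.isTopologicalBasis (G := G)).exists_subset_of_mem_open ha hW
  exact ⟨Restr.incl ⁻¹' S, ⟨hS.1.preimage (continuous_incl D), hbis S hS.2⟩, haS,
    Set.preimage_mono hSW⟩

/-- Units with trivial isotropy group are dense in the unit space. -/
def TopologicallyPrincipal (G : Type*) [TopologicalSpace G] [ArrowGroupoid G] : Prop :=
  Dense {u : UnitSpace G | {g : G | dom g = u ∧ rng g = u} = {u.arrow}}

/-- `G_D` is topologically principal for every closed invariant set `D` of units. -/
def EssentiallyPrincipal (G : Type*) [TopologicalSpace G] [ArrowGroupoid G] : Prop :=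
  ∀ D : Set (UnitSpace G), IsClosed D → IsInvariant D → TopologicallyPrincipal (Restr D)

/-- (Topological) amenability of an étale groupoid: there are nonnegative functions in `C_c(G)`
which, uniformly on compact sets, are approximately normalised on the fibres `G^u` and
approximately invariant. The sums have only finitely many nonzero terms. -/
def Amenable (G : Type*) [TopologicalSpace G] [ArrowGroupoid G] : Prop :=
  ∀ K : Set G, IsCompact K → ∀ ε : ℝ, 0 < ε → ∃ f : C_c(G, ℝ), (∀ g, 0 ≤ f g) ∧
    ∀ g ∈ K, |(∑' h : {h : G // rng h = rng g}, f h) - 1| < ε ∧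
      ∑' h : {h : G // rng h = rng g}, |f (g⁻¹ * h) - f h| < ε

end Topology
end ArrowGroupoid

namespace ArrowGroupoid

section FunctionSpaces

variable {X Y : Type*} [TopologicalSpace X] [TopologicalSpace Y]

open Classical in
/-- Extension by zero of a compactly supported function along an open embedding. -/
noncomputable def extendCc [T2Space Y] {e : X → Y} (he : Topology.IsOpenEmbedding e)
    (f : C_c(X, ℂ)) : C_c(Y, ℂ) where
  toFun := Function.extend e f 0
  continuous_toFun := by
    have hK : IsClosed (e '' tsupport f) :=
      (f.hasCompactSupport.isCompact.image he.continuous).isClosed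
    rw [continuous_iff_continuousAt]
    intro y
    by_cases hy : y ∈ Set.range e
    · obtain ⟨x, rfl⟩ := hy
      rw [← he.continuousAt_iff]
      exact f.continuous.continuousAt.congr
        (Filter.Eventually.of_forall fun x => (he.injective.extend_apply _ _ x).symm)
    · have hy' : y ∉ e '' tsupport f := fun ⟨x, _, hx⟩ => hy ⟨x, hx⟩
      refine (continuousAt_const (y := (0 : ℂ))).congr ?_
      filter_upwards [hK.isOpen_compl.mem_nhds hy'] with z hz
      by_cases hz' : z ∈ Set.range e
      · obtain ⟨x, rfl⟩ := hz'
        rw [he.injective.extend_apply]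
        by_contra h0
        exact hz ⟨x, subset_tsupport _ (Ne.symm h0), rfl⟩
      · rw [Function.extend_apply' _ _ _ hz']; rfl
  hasCompactSupport' := by
    refine HasCompactSupport.intro (f.hasCompactSupport.isCompact.image he.continuous) ?_
    intro z hz
    by_cases hz' : z ∈ Set.range e
    · obtain ⟨x, rfl⟩ := hz'
      rw [he.injective.extend_apply]
      by_contra h0
      exact hz ⟨x, subset_tsupport _ h0, rfl⟩
    · rw [Function.extend_apply' _ _ _ hz']; rfl

theorem extendCc_apply [T2Space Y] {e : X → Y} (he : Topology.IsOpenEmbedding e)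
    (f : C_c(X, ℂ)) (x : X) : extendCc he f (e x) = f x :=
  he.injective.extend_apply _ _ _

theorem extendCc_apply_of_notMem [T2Space Y] {e : X → Y} (he : Topology.IsOpenEmbedding e)
    (f : C_c(X, ℂ)) {y : Y} (hy : y ∉ Set.range e) : extendCc he f y = 0 :=
  Function.extend_apply' _ _ _ hy

/-- Restriction of a compactly supported function along a closed embedding. -/
noncomputable def restrictCc {e : X → Y} (he : Topology.IsClosedEmbedding e) (f : C_c(Y, ℂ)) : C_c(X, ℂ) where
  toFun := f ∘ e
  continuous_toFun := f.continuous.comp he.continuous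
  hasCompactSupport' := f.hasCompactSupport.comp_isClosedEmbedding he

theorem restrictCc_apply {e : X → Y} (he : Topology.IsClosedEmbedding e) (f : C_c(Y, ℂ)) (x : X) :
    restrictCc he f x = f (e x) := rfl

/-- The Hilbert space `ℓ²(X)`. -/
abbrev ell2 (X : Type*) : Type _ := lp (fun _ : X => ℂ) 2

theorem enorm_sq_eq (z : ℂ) : ENNReal.ofReal (‖z‖ ^ (2 : ℝ)) = ‖z‖ₑ ^ (2 : ℝ) := by
  rw [← ofReal_norm, ENNReal.ofReal_rpow_of_nonneg (norm_nonneg _) (by norm_num)]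

theorem ell2_enorm {X : Type*} (ξ : ell2 X) :
    ENNReal.ofReal (‖ξ‖ ^ (2 : ℝ)) = ∑' x, ‖ξ x‖ₑ ^ (2 : ℝ) := by
  have h2 : 0 < (2 : ℝ≥0∞).toReal := by norm_num
  have h := lp.norm_rpow_eq_tsum h2 ξ
  have hs := (lp.memℓp ξ).summable h2
  simp only [ENNReal.toReal_ofNat] at h hs
  rw [h, ENNReal.ofReal_tsum_of_nonneg (fun x => by positivity) hs]
  simp only [enorm_sq_eq]

theorem memℓp_of_tsum_ne_top {X : Type*} {a : X → ℂ} (h : ∑' x, ‖a x‖ₑ ^ (2 : ℝ) ≠ ⊤) :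
    Memℓp a 2 := by
  apply memℓp_gen
  have := ENNReal.summable_toReal h
  refine this.congr fun x => ?_
  simp only [ENNReal.toReal_ofNat]
  rw [← enorm_sq_eq, ENNReal.toReal_ofReal (by positivity)]

theorem ell2_norm_le {X : Type*} {ξ η : ell2 X} {c : ℝ} (hc : 0 ≤ c)
    (h : ∀ x, ‖η x‖ ≤ c * ‖ξ x‖) : ‖η‖ ≤ c * ‖ξ‖ := by
  have h1 : ENNReal.ofReal (‖η‖ ^ (2 : ℝ)) ≤ ENNReal.ofReal ((c * ‖ξ‖) ^ (2 : ℝ)) := by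
    rw [Real.mul_rpow hc (norm_nonneg _), ENNReal.ofReal_mul (by positivity), ell2_enorm,
      ell2_enorm, ← ENNReal.tsum_mul_left]
    refine ENNReal.tsum_le_tsum fun x => ?_
    rw [← enorm_sq_eq, ← enorm_sq_eq, ← ENNReal.ofReal_mul (by positivity),
      ← Real.mul_rpow hc (norm_nonneg _)]
    exact ENNReal.ofReal_le_ofReal (Real.rpow_le_rpow (norm_nonneg _) (h x) (by norm_num))
  rw [ENNReal.ofReal_le_ofReal_iff (by positivity)] at h1
  exact (Real.rpow_le_rpow_iff (norm_nonneg _) (by positivity) (by norm_num)).1 h1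

/-- A linear formula on `ℓ²(X)` that satisfies an `ℓ²`-bound defines a bounded operator. -/
noncomputable def ell2Op {X : Type*} (A : ell2 X → X → ℂ)
    (hadd : ∀ ξ η x, A (ξ + η) x = A ξ x + A η x)
    (hsmul : ∀ (c : ℂ) ξ x, A (c • ξ) x = c * A ξ x)
    (hb : ∃ M : ℝ, 0 ≤ M ∧ ∀ ξ : ell2 X,
      ∑' x, ‖A ξ x‖ₑ ^ (2 : ℝ) ≤ ENNReal.ofReal M ^ (2 : ℝ) * ∑' x, ‖ξ x‖ₑ ^ (2 : ℝ)) :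
    ell2 X →L[ℂ] ell2 X :=
  have hmem : ∀ ξ, Memℓp (A ξ) 2 := fun ξ => by
    obtain ⟨M, hM, h⟩ := hb
    apply memℓp_of_tsum_ne_top
    refine ne_top_of_le_ne_top ?_ (h ξ)
    rw [← ell2_enorm]
    exact ENNReal.mul_ne_top (by simp) ENNReal.ofReal_ne_top
  LinearMap.mkContinuousOfExistsBound
    { toFun := fun ξ => (⟨A ξ, hmem ξ⟩ : lp (fun _ : X => ℂ) 2)
      map_add' := fun ξ η => by
        ext x
        exact hadd ξ η x
      map_smul' := fun c ξ => by
        ext x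
        exact hsmul c ξ x }
    (by
      obtain ⟨M, hM, h⟩ := hb
      refine ⟨M, fun ξ => ?_⟩
      have h1 := h ξ
      rw [← ell2_enorm] at h1
      have h2 := ell2_enorm (⟨A ξ, hmem ξ⟩ : lp (fun _ : X => ℂ) 2)
      have h3 : ENNReal.ofReal (‖(⟨A ξ, hmem ξ⟩ : lp (fun _ : X => ℂ) 2)‖ ^ (2 : ℝ)) ≤
          ENNReal.ofReal ((M * ‖ξ‖) ^ (2 : ℝ)) := by
        rw [h2, Real.mul_rpow hM (norm_nonneg _), ENNReal.ofReal_mul (by positivity),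
          ← ENNReal.ofReal_rpow_of_nonneg hM (by norm_num)]
        exact h1
      rw [ENNReal.ofReal_le_ofReal_iff (by positivity)] at h3
      exact (Real.rpow_le_rpow_iff (norm_nonneg _) (by positivity) (by norm_num)).1 h3)

theorem ell2Op_apply {X : Type*} (A : ell2 X → X → ℂ) (hadd) (hsmul) (hb) (ξ : ell2 X) (x : X) :
    ell2Op A hadd hsmul hb ξ x = A ξ x := rfl

/-- Multiplication by a bounded function, as an operator on `ℓ²(X)`. -/
noncomputable def mulOp {X : Type*} (a : X → ℂ) (ha : ∃ C, ∀ x, ‖a x‖ ≤ C) :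
    ell2 X →L[ℂ] ell2 X :=
  ell2Op (fun ξ x => a x * ξ x) (fun ξ η x => by rw [lp.coeFn_add, Pi.add_apply, mul_add])
    (fun c ξ x => by rw [lp.coeFn_smul, Pi.smul_apply, smul_eq_mul, mul_left_comm])
    (by
      obtain ⟨C, hC⟩ := ha
      refine ⟨max C 0, le_max_right _ _, fun ξ => ?_⟩
      rw [← ENNReal.tsum_mul_left]
      refine ENNReal.tsum_le_tsum fun x => ?_
      rw [enorm_mul, ENNReal.mul_rpow_of_nonneg _ _ (by norm_num)]
      gcongr
      rw [← ofReal_norm]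
      exact ENNReal.ofReal_le_ofReal ((hC x).trans (le_max_left _ _)))

theorem mulOp_apply {X : Type*} (a : X → ℂ) (ha) (ξ : ell2 X) (x : X) :
    mulOp a ha ξ x = a x * ξ x := rfl

end FunctionSpaces

section RegularRepresentation

variable {G : Type*} [TopologicalSpace G] [ArrowGroupoid G]

theorem exists_bisection_cover [IsEtale G] (f : C_c(G, ℂ)) :
    ∃ (t : Finset G) (S : G → Set G), (∀ x, IsBisection (S x)) ∧
      ∀ h, f h ≠ 0 → ∃ x ∈ t, h ∈ S x := by
  have hex : ∀ x : G, ∃ S : Set G, (IsOpen S ∧ IsBisection S) ∧ x ∈ S := fun x => by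
    obtain ⟨S, hS, hx, -⟩ := (IsEtale.isTopologicalBasis (G := G)).exists_subset_of_mem_open
      (Set.mem_univ x) isOpen_univ
    exact ⟨S, hS, hx⟩
  choose S hS hx using hex
  obtain ⟨t, -, ht⟩ := f.hasCompactSupport.isCompact.elim_nhds_subcover S
    (fun x _ => (hS x).1.mem_nhds (hx x))
  refine ⟨t, S, fun x => (hS x).2, fun h hh => ?_⟩
  simpa using ht (subset_tsupport _ hh)

theorem IsBisection.rng_inj {S : Set G} (hS : IsBisection S) {a b : G} (ha : a ∈ S) (hb : b ∈ S)
    (h : rng a = rng b) : a = b :=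
  congrArg (fun z : S => (z : G)) (@hS.1.injective ⟨a, ha⟩ ⟨b, hb⟩ (congrArg UnitSpace.arrow h))

theorem IsBisection.dom_inj {S : Set G} (hS : IsBisection S) {a b : G} (ha : a ∈ S) (hb : b ∈ S)
    (h : dom a = dom b) : a = b :=
  congrArg (fun z : S => (z : G)) (@hS.2.injective ⟨a, ha⟩ ⟨b, hb⟩ (congrArg UnitSpace.arrow h))

theorem finite_fibre [IsEtale G] (f : C_c(G, ℂ)) (u : UnitSpace G) :
    {h : {h : G // rng h = u} | f h ≠ 0}.Finite := by
  obtain ⟨t, S, hS, hcov⟩ := exists_bisection_cover f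
  refine (t.finite_toSet.biUnion (t := fun x => {h : {h : G // rng h = u} | (h : G) ∈ S x})
    fun x _ => ?_).subset ?_
  · refine Set.Subsingleton.finite fun a ha b hb => Subtype.ext ?_
    exact (hS x).rng_inj ha hb (a.2.trans b.2.symm)
  · intro h hh
    obtain ⟨x, hx, hm⟩ := hcov h hh
    exact Set.mem_biUnion hx hm

theorem exists_fibre_bound [IsEtale G] (f : C_c(G, ℂ)) :
    ∃ M : ℝ, 0 ≤ M ∧ (∀ u, ∑' h : {h : G // rng h = u}, ‖f h‖ₑ ≤ ENNReal.ofReal M) ∧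
      (∀ u, ∑' h : {h : G // dom h = u}, ‖f h‖ₑ ≤ ENNReal.ofReal M) := by
  classical
  obtain ⟨t, S, hS, hcov⟩ := exists_bisection_cover f
  obtain ⟨C, hC⟩ := f.hasCompactSupport.exists_bound_of_continuous f.continuous
  have hC' : ∀ h, ‖f h‖ₑ ≤ ENNReal.ofReal C := fun h => by
    rw [← ofReal_norm]; exact ENNReal.ofReal_le_ofReal (hC h)
  have key : ∀ F : Set G, (∀ x, (F ∩ S x).Subsingleton) →
      ∑' h : F, ‖f h‖ₑ ≤ t.card * ENNReal.ofReal C := by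
    intro F hF
    have h1 : ∀ h : F, ‖f h‖ₑ ≤ ∑ x ∈ t, if (h : G) ∈ S x then ENNReal.ofReal C else 0 := by
      intro h
      by_cases hh : f h = 0
      · simp [hh]
      · obtain ⟨x, hx, hm⟩ := hcov h hh
        calc ‖f h‖ₑ ≤ if (h : G) ∈ S x then ENNReal.ofReal C else 0 := by
              rw [if_pos hm]; exact hC' h
          _ ≤ _ := Finset.single_le_sum
            (f := fun x => if (h : G) ∈ S x then ENNReal.ofReal C else 0) (fun _ _ => zero_le) hx
    refine (ENNReal.tsum_le_tsum h1).trans ?_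
    rw [Summable.tsum_finsetSum (fun _ _ => ENNReal.summable), ← nsmul_eq_mul, ← Finset.sum_const]
    refine Finset.sum_le_sum fun x _ => ?_
    by_cases hx : ∃ h : F, (h : G) ∈ S x
    · obtain ⟨h, hh⟩ := hx
      rw [tsum_eq_single h]
      · rw [if_pos hh]
      · intro b hb
        rw [if_neg]
        intro hbm
        exact hb (Subtype.ext (hF x ⟨b.2, hbm⟩ ⟨h.2, hh⟩))
    · push Not at hx
      simp [hx]
  refine ⟨t.card * max C 0, by positivity, fun u => ?_, fun u => ?_⟩
  · refine (key {h | rng h = u} fun x a ha b hb =>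
      (hS x).rng_inj ha.2 hb.2 (ha.1.trans hb.1.symm)).trans ?_
    rw [ENNReal.ofReal_mul (by positivity), ENNReal.ofReal_natCast]
    gcongr
    exact le_max_left _ _
  · refine (key {h | dom h = u} fun x a ha b hb =>
      (hS x).dom_inj ha.2 hb.2 (ha.1.trans hb.1.symm)).trans ?_
    rw [ENNReal.ofReal_mul (by positivity), ENNReal.ofReal_natCast]
    gcongr
    exact le_max_left _ _

theorem weighted_cauchy {ι : Type*} (w b : ι → ℝ≥0∞) :
    (∑' i, w i * b i) ^ (2 : ℝ) ≤ (∑' i, w i) * ∑' i, w i * b i ^ (2 : ℝ) := by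
  have h : ∑' i, w i * b i ≤
      (∑' i, w i) ^ (1 - (2 : ℝ)⁻¹) * (∑' i, w i * b i ^ (2 : ℝ)) ^ (2 : ℝ)⁻¹ := by
    rw [ENNReal.tsum_eq_iSup_sum]
    refine iSup_le fun s => ?_
    refine (ENNReal.inner_le_weight_mul_Lp_of_nonneg s (p := 2) (by norm_num) w b).trans ?_
    exact mul_le_mul' (ENNReal.rpow_le_rpow (ENNReal.sum_le_tsum s) (by norm_num))
      (ENNReal.rpow_le_rpow (ENNReal.sum_le_tsum s) (by norm_num))
  refine (ENNReal.rpow_le_rpow h (by norm_num : (0 : ℝ) ≤ 2)).trans ?_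
  rw [ENNReal.mul_rpow_of_nonneg _ _ (by norm_num), ← ENNReal.rpow_mul, ← ENNReal.rpow_mul]
  norm_num

theorem conv_bound [IsEtale G] (f : C_c(G, ℂ)) :
    ∃ M : ℝ, 0 ≤ M ∧ ∀ ξ : ell2 G,
      ∑' g, ‖∑' h : {h : G // rng h = rng g}, f h * ξ ((h : G)⁻¹ * g)‖ₑ ^ (2 : ℝ) ≤
        ENNReal.ofReal M ^ (2 : ℝ) * ∑' g, ‖ξ g‖ₑ ^ (2 : ℝ) := by
  obtain ⟨M, hM, h1, h2⟩ := exists_fibre_bound f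
  refine ⟨M, hM, fun ξ => ?_⟩
  set B := ENNReal.ofReal M
  calc ∑' g, ‖∑' h : {h : G // rng h = rng g}, f h * ξ ((h : G)⁻¹ * g)‖ₑ ^ (2 : ℝ)
      ≤ ∑' g, B * ∑' h : {h : G // rng h = rng g}, ‖f h‖ₑ * ‖ξ ((h : G)⁻¹ * g)‖ₑ ^ (2 : ℝ) := by
        refine ENNReal.tsum_le_tsum fun g => ?_
        refine (ENNReal.rpow_le_rpow enorm_tsum_le_tsum_enorm (by norm_num)).trans ?_
        simp only [enorm_mul]
        refine (weighted_cauchy _ _).trans ?_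
        gcongr
        exact h1 _
    _ = B * ∑' k, ∑' h : {h : G // dom h = rng k}, ‖f h‖ₑ * ‖ξ k‖ₑ ^ (2 : ℝ) := by
        rw [ENNReal.tsum_mul_left, ← ENNReal.tsum_sigma (fun (g : G)
          (h : {h : G // rng h = rng g}) => ‖f h‖ₑ * ‖ξ ((h : G)⁻¹ * g)‖ₑ ^ (2 : ℝ)),
          ← ENNReal.tsum_sigma (fun (k : G)
          (h : {h : G // dom h = rng k}) => ‖f h‖ₑ * ‖ξ k‖ₑ ^ (2 : ℝ)),
          ← (fibreEquiv G).tsum_eq]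
        rfl
    _ ≤ B * ∑' k, B * ‖ξ k‖ₑ ^ (2 : ℝ) := by
        gcongr with k
        rw [ENNReal.tsum_mul_right]
        gcongr
        exact h2 _
    _ = _ := by
        rw [ENNReal.tsum_mul_left, ← mul_assoc]
        congr 1
        rw [ENNReal.rpow_two, sq]

theorem conv_summable [IsEtale G] (f : C_c(G, ℂ)) (ξ : ell2 G) (g : G) :
    Summable fun h : {h : G // rng h = rng g} => f h * ξ ((h : G)⁻¹ * g) := by
  refine summable_of_hasFiniteSupport ((finite_fibre f (rng g)).subset fun h hh => ?_)
  exact left_ne_zero_of_mul hh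

/-- The regular representation `f ↦ ⨁ᵤ πᵤ(f)` of `C_c(G)` on `ℓ²(G) = ⨁ᵤ ℓ²(G_u)`, the sum over
all units `u`: it maps `ξ` to the convolution
`(f * ξ)(g) = ∑ f(h) ξ(h⁻¹ g)`, the sum over `h ∈ G^{r(g)}`. Its norm is
`sup_u ‖πᵤ(f)‖`, the reduced norm of `f`. -/
noncomputable def regularRep [IsEtale G] (f : C_c(G, ℂ)) : ell2 G →L[ℂ] ell2 G :=
  ell2Op (fun ξ g => ∑' h : {h : G // rng h = rng g}, f h * ξ ((h : G)⁻¹ * g))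
    (fun ξ η g => by
      rw [← (conv_summable f ξ g).tsum_add (conv_summable f η g)]
      exact tsum_congr fun h => by rw [lp.coeFn_add, Pi.add_apply, mul_add])
    (fun c ξ g => by
      rw [← tsum_mul_left]
      exact tsum_congr fun h => by
        rw [lp.coeFn_smul, Pi.smul_apply, smul_eq_mul, mul_left_comm])
    (conv_bound f)

theorem regularRep_apply [IsEtale G] (f : C_c(G, ℂ)) (ξ : ell2 G) (g : G) :
    regularRep f ξ g = ∑' h : {h : G // rng h = rng g}, f h * ξ ((h : G)⁻¹ * g) := rfl

/-- The reduced `C*`-algebra of an étale groupoid: the norm closure of the `*`-algebra of all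
operators `regularRep f`, `f ∈ C_c(G)`; that is, the completion of `C_c(G)` in the reduced norm. -/
noncomputable def reducedCStar (G : Type*) [TopologicalSpace G] [ArrowGroupoid G] [IsEtale G] :
    NonUnitalStarSubalgebra ℂ (ell2 G →L[ℂ] ell2 G) :=
  (NonUnitalStarAlgebra.adjoin ℂ (Set.range (regularRep (G := G)))).topologicalClosure

/-- The canonical map `C_c(G) → C_r^*(G)`. -/
noncomputable def toReduced [IsEtale G] (f : C_c(G, ℂ)) : reducedCStar G :=
  ⟨regularRep f, NonUnitalStarSubalgebra.le_topologicalClosure _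
    (NonUnitalStarAlgebra.subset_adjoin _ _ ⟨f, rfl⟩)⟩

/-- Inner exactness: for every closed invariant `D`, with complement `U`, the sequence
`0 → C_r^*(G_U) → C_r^*(G) → C_r^*(G_D) → 0`, whose maps are induced by extension by zero
and by restriction of functions, is exact. -/
def InnerExact (G : Type*) [TopologicalSpace G] [ArrowGroupoid G] [IsEtale G] : Prop :=
  ∀ (D : Set (UnitSpace G)) (hD : IsClosed D) (hinv : IsInvariant D),
    haveI : IsEtale (Restr D) := isEtale_restr hinv (Or.inl hD)
    haveI : IsEtale (Restr Dᶜ) := isEtale_restr hinv.compl (Or.inr hD.isOpen_compl)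
    ∃ (ι : reducedCStar (Restr Dᶜ) →⋆ₙₐ[ℂ] reducedCStar G)
      (π : reducedCStar G →⋆ₙₐ[ℂ] reducedCStar (Restr D)),
      (∀ f : C_c(Restr Dᶜ, ℂ),
        ι (toReduced f) = toReduced (extendCc (isOpenEmbedding_incl hD.isOpen_compl) f)) ∧
      (∀ f : C_c(G, ℂ), π (toReduced f) = toReduced (restrictCc (isClosedEmbedding_incl hD) f)) ∧
      Function.Injective ι ∧ (∀ a, π a = 0 ↔ a ∈ Set.range ι) ∧ Function.Surjective π

instance [IsEtale G] : T2Space (UnitSpace G) :=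
  inferInstanceAs (T2Space {u : G // ∃ g : G, u = g * g⁻¹})

theorem isOpenEmbedding_arrow [IsEtale G] :
    Topology.IsOpenEmbedding (UnitSpace.arrow (G := G)) := by
  refine IsOpen.isOpenEmbedding_subtypeVal (isOpen_iff_mem_nhds.2 ?_)
  rintro _ ⟨g, rfl⟩
  obtain ⟨S, hS, hx, -⟩ := (IsEtale.isTopologicalBasis (G := G)).exists_subset_of_mem_open
      (Set.mem_univ g) isOpen_univ
  refine Filter.mem_of_superset (hS.2.1.isOpen_range.mem_nhds ⟨⟨g, hx⟩, rfl⟩) ?_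
  rintro _ ⟨h, rfl⟩
  exact ⟨h, rfl⟩

theorem exists_bound_C0 {X : Type*} [TopologicalSpace X] (f : C₀(X, ℂ)) : ∃ C, ∀ x, ‖f x‖ ≤ C :=
  ⟨‖f.toBCF‖, fun x => f.toBCF.norm_coe_le_norm x⟩

/-- The operator by which `f ∈ C_0(G⁽⁰⁾)` acts on `ℓ²(G)`: multiplication by `f ∘ r`. -/
noncomputable def diagOp (f : C₀(UnitSpace G, ℂ)) : ell2 G →L[ℂ] ell2 G :=
  mulOp (fun g => f (rng g)) ((exists_bound_C0 f).imp fun _ hC g => hC (rng g))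

theorem diagOp_apply (f : C₀(UnitSpace G, ℂ)) (ξ : ell2 G) (g : G) :
    diagOp f ξ g = f (rng g) * ξ g := rfl

/-- On `C_c(G⁽⁰⁾)` the operator `diagOp` is the regular representation. -/
theorem regularRep_extendCc [IsEtale G] (f : C_c(UnitSpace G, ℂ)) (ξ : ell2 G) (g : G) :
    regularRep (extendCc isOpenEmbedding_arrow f) ξ g = f (rng g) * ξ g := by
  rw [regularRep_apply, tsum_eq_single ⟨(rng g).arrow, rng_unit _⟩]
  · rw [extendCc_apply, unit_mul]
  · rintro ⟨h, hh⟩ hne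
    rw [extendCc_apply_of_notMem, zero_mul]
    rintro ⟨u, rfl⟩
    rw [rng_unit] at hh
    exact hne (Subtype.ext (congrArg UnitSpace.arrow hh))

/-- Truncation: cuts off the values of absolute value below `ε`. -/
noncomputable def trunc (ε : ℝ) (z : ℂ) : ℂ :=
  z * ((max (‖z‖ - ε) 0 / max ‖z‖ ε : ℝ) : ℂ)

theorem trunc_spec {ε : ℝ} (hε : 0 < ε) :
    Continuous (trunc ε) ∧ (∀ z, ‖z‖ ≤ ε → trunc ε z = 0) ∧ ∀ z, ‖z - trunc ε z‖ ≤ ε := by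
  refine ⟨?_, ?_, ?_⟩
  · unfold trunc
    refine continuous_id.mul (Complex.continuous_ofReal.comp ?_)
    refine Continuous.div (by fun_prop) (by fun_prop) fun z => ?_
    exact (lt_of_lt_of_le hε (le_max_right _ _)).ne'
  · intro z hz
    rw [trunc, max_eq_right (by linarith : ‖z‖ - ε ≤ 0)]
    simp
  · intro z
    rcases le_total ‖z‖ ε with hz | hz
    · rw [trunc, max_eq_right (by linarith : ‖z‖ - ε ≤ 0)]
      simpa using hz
    · have hz0 : 0 < ‖z‖ := hε.trans_le hz
      rw [trunc, max_eq_left (by linarith : 0 ≤ ‖z‖ - ε), max_eq_left hz]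
      have : z - z * (((‖z‖ - ε) / ‖z‖ : ℝ) : ℂ) = z * ((ε / ‖z‖ : ℝ) : ℂ) := by
        rw [sub_div, div_self hz0.ne']
        push_cast
        ring
      rw [this, norm_mul, Complex.norm_real, Real.norm_eq_abs, abs_of_pos (by positivity)]
      field_simp
      exact le_refl _

theorem exists_approx_Cc {X : Type*} [TopologicalSpace X] [T2Space X] (f : C₀(X, ℂ)) {ε : ℝ} (hε : 0 < ε) :
    ∃ f' : C_c(X, ℂ), ∀ x, ‖f x - f' x‖ ≤ ε := by
  obtain ⟨h1, h2, h3⟩ := trunc_spec hε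
  have h0 : ∀ᶠ x in Filter.cocompact X, ‖f x‖ < ε := by
    have := (f.zero_at_infty').norm
    rw [norm_zero] at this
    exact this.eventually_lt_const hε
  obtain ⟨K, hK, hKs⟩ := Filter.mem_cocompact'.1 h0
  refine ⟨⟨⟨fun x => trunc ε (f x), h1.comp f.continuous⟩, ?_⟩, fun x => h3 _⟩
  refine HasCompactSupport.intro hK fun x hx => h2 _ ?_
  by_contra hlt
  exact hx (hKs fun h => hlt (le_of_lt h))

theorem diagOp_mem [IsEtale G] (f : C₀(UnitSpace G, ℂ)) : diagOp f ∈ reducedCStar G := by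
  change diagOp f ∈ closure _
  rw [Metric.mem_closure_iff]
  intro ε hε
  obtain ⟨f', hf'⟩ := exists_approx_Cc f (half_pos hε)
  refine ⟨regularRep (extendCc isOpenEmbedding_arrow f'),
    NonUnitalStarAlgebra.subset_adjoin _ _ ⟨_, rfl⟩, ?_⟩
  rw [dist_eq_norm]
  refine lt_of_le_of_lt (ContinuousLinearMap.opNorm_le_bound _ (half_pos hε).le fun ξ => ?_)
    (half_lt_self hε)
  refine ell2_norm_le (half_pos hε).le fun g => ?_
  have h1 : ((diagOp f - regularRep (extendCc isOpenEmbedding_arrow f')) ξ) g =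
      (f (rng g) - f' (rng g)) * ξ g := by
    rw [sub_mul, ← diagOp_apply, ← regularRep_extendCc]
    rfl
  rw [h1, norm_mul]
  exact mul_le_mul_of_nonneg_right (hf' _) (norm_nonneg _)

/-- The embedding of `C_0(G⁽⁰⁾)` into `C_r^*(G)`. -/
noncomputable def diag [IsEtale G] (f : C₀(UnitSpace G, ℂ)) : reducedCStar G :=
  ⟨diagOp f, diagOp_mem f⟩

/-- The closed two-sided ideals of `C_r^*(G)`. -/
def ClosedIdeal (G : Type*) [TopologicalSpace G] [ArrowGroupoid G] [IsEtale G] : Type _ :=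
  {I : TwoSidedIdeal (reducedCStar G) // IsClosed {a | a ∈ I}}

/-- The set `U_I`: the union of the sets `{f ≠ 0}` over all `f ∈ I ∩ C_0(G⁽⁰⁾)`. -/
def idealSupport [IsEtale G] (I : ClosedIdeal G) : Set (UnitSpace G) :=
  {u | ∃ f : C₀(UnitSpace G, ℂ), diag f ∈ I.1 ∧ f u ≠ 0}

/-- `C_0(G⁽⁰⁾)` separates the ideals of `C_r^*(G)`: the map `I ↦ U_I` is injective. -/
def SeparatesIdeals (G : Type*) [TopologicalSpace G] [ArrowGroupoid G] [IsEtale G] : Prop :=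
  Function.Injective (idealSupport (G := G))

end RegularRepresentation
end ArrowGroupoid

/-! Every `a` in the reduced algebra has a continuous coefficient function `coef a` on `G`, which
determines `a` and satisfies `‖coef a x‖ ≤ ‖a‖`. Write `U` for the support of a closed ideal `I` and
`D` for its complement, a closed invariant set.

If `G` is essentially principal, coefficients of elements of `I` vanish on `G_D`
(`coef_eq_zero_of_mem`). Indeed, let `a ∈ I` with `coef a u ≠ 0` at a unit `u` with trivial
isotropy. Approximate `a` by some `f ∈ C_c(G)` and cut down on both sides by a bump near `u`: only
the diagonal part of `f` survives, and after normalisation `I` comes within distance less than one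
of a function that is one near `u`. A geometric series then puts a function nonzero at `u` into `I`,
so `u ∈ U`. Density of such units in `D` and the identity `coef (a* a) u = ‖a δ_u‖²` give the rest.
Conversely, functions in `C_c(G)` vanishing on `G_D` always lie in `I`
(`ClosedIdeal.toReduced_mem`). Hence, if elements with coefficients vanishing on `G_D` are limits of
such functions (`VanishingApproximation`), then `I` consists of all `a` with `coef a = 0` on `G_D`,
and `U` determines `I`.

Inner exactness gives the approximation because such an `a` is killed by restriction to `G_D`, hence
comes from `G_U`. Amenability gives it through the multipliers `h = ξ * ξ^*`, which are uniformly
bounded for the reduced norm and close to one on compact sets: `h · coef a` is in `C_c(G)`, vanishes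
where `coef a` does, and is close to `a`.

For the converse, fix a closed invariant `D` and compare two ideals of `C_c(G)`: the functions
vanishing on `G_D`, and those acting as zero on functions on `D`. Amenability bounds sums over
isotropy groups by the reduced norm, so both closures have support `Dᶜ`, and separation makes them
equal. If isotropy elements filled an open subset of `G_D` containing a non-unit, a bump `f` on a
bisection there would give `|f|² - f * f^*`, which acts as zero on `D` without vanishing on `G_D`.
So `G_D` is effective, and σ-compactness with Baire's theorem makes it topologically principal. -/

namespace ArrowGroupoid

/-! ### Groupoid identities and convolution without topology. -/

section GroupoidAlgebra

variable {G : Type*} [ArrowGroupoid G]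

theorem inv_mul_cancel_left' {g h : G} (H : dom g = rng h) : g⁻¹ * (g * h) = h :=
  (inv_comp_cancel ((composable_iff _ _).2 H)).2

theorem mul_inv_cancel_right' {g h : G} (H : dom g = rng h) : g * h * h⁻¹ = g :=
  (comp_inv_cancel ((composable_iff _ _).2 H)).2

theorem mul_inv_cancel_left' {g h : G} (H : rng g = rng h) : g * (g⁻¹ * h) = h := by
  have := inv_mul_cancel_left' (g := g⁻¹) (h := h) (by rw [dom_inv, H])
  rwa [inv_invol] at this

theorem inv_mul_cancel_right' {g h : G} (H : dom g = dom h) : g * h⁻¹ * h = g := by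
  have := mul_inv_cancel_right' (g := g) (h := h⁻¹) (by rw [rng_inv, H])
  rwa [inv_invol] at this

theorem dom_mul' {g h : G} (H : dom g = rng h) : dom (g * h) = dom h :=
  dom_mul ((composable_iff _ _).2 H)

theorem rng_mul' {g h : G} (H : dom g = rng h) : rng (g * h) = rng g :=
  rng_mul ((composable_iff _ _).2 H)

theorem mul_assoc' {a b c : G} (H : dom a = rng b) (H' : dom b = rng c) :
    a * b * c = a * (b * c) :=
  (comp_assoc ((composable_iff _ _).2 H) ((composable_iff _ _).2 H')).2.2

theorem dom_inv_mul {g h : G} (H : rng g = rng h) : dom (g⁻¹ * h) = dom h :=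
  dom_mul' (by rw [dom_inv, H])

theorem rng_inv_mul {g h : G} (H : rng g = rng h) : rng (g⁻¹ * h) = dom g := by
  rw [rng_mul' (by rw [dom_inv, H]), rng_inv]

theorem rng_mul_inv {g h : G} (H : dom g = dom h) : rng (g * h⁻¹) = rng g :=
  rng_mul' (by rw [rng_inv, H])

theorem inv_mul_rev {g h : G} (H : dom g = rng h) : (g * h)⁻¹ = h⁻¹ * g⁻¹ := by
  have h1 : g⁻¹ = h * (g * h)⁻¹ := by
    have := mul_inv_cancel_right' (g := g⁻¹) (h := g * h) (by rw [dom_inv, rng_mul' H])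
    rw [inv_mul_cancel_left' H] at this
    exact this.symm
  rw [h1, inv_mul_cancel_left']
  rw [rng_inv, dom_mul' H]

theorem inv_mul_inv_rev {g h : G} (H : rng g = rng h) : (g⁻¹ * h)⁻¹ = h⁻¹ * g := by
  rw [inv_mul_rev (by rw [dom_inv, H]), inv_invol]

theorem mul_inv_inv_rev {g h : G} (H : dom g = dom h) : (g * h⁻¹)⁻¹ = h * g⁻¹ := by
  rw [inv_mul_rev (by rw [rng_inv, H]), inv_invol]

theorem arrow_inv (u : UnitSpace G) : u.arrow⁻¹ = u.arrow := by
  obtain ⟨_, g, rfl⟩ := u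
  exact (mul_inv_inv_rev rfl)

theorem arrow_mul {u : UnitSpace G} {g : G} (h : u = rng g) : u.arrow * g = g := by
  subst h
  have := unit_mul g
  rwa [arrow_inv] at this

theorem mul_arrow {u : UnitSpace G} {g : G} (h : u = dom g) : g * u.arrow = g := by
  subst h
  rw [dom_arrow]
  exact mul_inv_cancel_left' (g := g) (h := g) rfl

theorem mul_inv_self (g : G) : g * g⁻¹ = (rng g).arrow := rfl

theorem eq_of_inv_mul_eq_arrow {g h : G} {u : UnitSpace G} (H : rng g = rng h)
    (h1 : g⁻¹ * h = u.arrow) : g = h := by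
  have h2 : u = dom g := by rw [← rng_unit u, ← h1, rng_inv_mul H]
  rw [← mul_inv_cancel_left' H, h1, mul_arrow h2]

theorem eq_arrow_of_mul_left {g h : G} (H : dom g = rng h) (h1 : g * h = h) :
    g = (rng h).arrow := by
  rw [← mul_inv_cancel_right' H, h1, mul_inv_self]

/-- Left multiplication by `x` as a bijection `G^{d(x)} → G^{r(x)}`. -/
def leftMulEquiv (x : G) : {l : G // rng l = dom x} ≃ {p : G // rng p = rng x} where
  toFun l := ⟨x * l, rng_mul' l.2.symm⟩
  invFun p := ⟨x⁻¹ * p, by rw [rng_inv_mul p.2.symm]⟩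
  left_inv l := Subtype.ext (inv_mul_cancel_left' l.2.symm)
  right_inv p := Subtype.ext (mul_inv_cancel_left' p.2.symm)

theorem leftMulEquiv_apply (x : G) (l : {l : G // rng l = dom x}) :
    (leftMulEquiv x l : G) = x * l := rfl

/-- The convolution of two functions on a groupoid. -/
noncomputable def conv (f ψ : G → ℂ) (x : G) : ℂ :=
  ∑' h : {h : G // rng h = rng x}, f h * ψ ((h : G)⁻¹ * x)

/-- The involution of a function on a groupoid. -/
noncomputable def invol (f : G → ℂ) (x : G) : ℂ := star (f x⁻¹)

/-- Functions with finitely many nonzero values on each fibre of the range map. -/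
def FibreFinite (f : G → ℂ) : Prop := ∀ u : UnitSpace G, {h : {h : G // rng h = u} | f h ≠ 0}.Finite

theorem FibreFinite.summable {f : G → ℂ} (hf : FibreFinite f) (u : UnitSpace G)
    (ψ : {h : G // rng h = u} → ℂ) :
    Summable fun h : {h : G // rng h = u} => f h * ψ h :=
  summable_of_hasFiniteSupport ((hf u).subset fun _ hh => left_ne_zero_of_mul hh)

theorem conv_eq_tsum {f ψ : G → ℂ} {x : G} {u : UnitSpace G} (h : rng x = u) :
    conv f ψ x = ∑' h : {h : G // rng h = u}, f h * ψ ((h : G)⁻¹ * x) := by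
  subst h; rfl

/-- Substituting `h = k l` turns both sides into one double sum, which is finite because of `f` and
`g` alone. Leaving `ψ` arbitrary covers vectors of `ℓ²(G)` and functions `η ∘ rng` as well as
elements of `C_c(G)`. -/
theorem conv_assoc {f g : G → ℂ} (hf : FibreFinite f) (hg : FibreFinite g) (ψ : G → ℂ) :
    conv (conv f g) ψ = conv f (conv g ψ) := by
  funext x
  have h1 : conv (conv f g) ψ x = ∑' (h : {h : G // rng h = rng x})
      (k : {h : G // rng h = rng x}), f k * (g ((k : G)⁻¹ * h) * ψ ((h : G)⁻¹ * x)) := by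
    refine tsum_congr fun h => ?_
    rw [conv_eq_tsum h.2, ← tsum_mul_right]
    exact tsum_congr fun k => mul_assoc _ _ _
  have h2 : conv f (conv g ψ) x = ∑' (k : {h : G // rng h = rng x})
      (h : {h : G // rng h = rng x}), f k * (g ((k : G)⁻¹ * h) * ψ ((h : G)⁻¹ * x)) := by
    refine tsum_congr fun k => ?_
    rw [tsum_mul_left]
    congr 1
    rw [conv_eq_tsum (rng_inv_mul k.2)]
    have h3 : ∑' h : {h : G // rng h = rng (k : G)}, g ((k : G)⁻¹ * h) * ψ ((h : G)⁻¹ * x) =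
        ∑' l : {l : G // rng l = dom (k : G)}, g l * ψ ((l : G)⁻¹ * ((k : G)⁻¹ * x)) := by
      rw [← (leftMulEquiv (k : G)).tsum_eq]
      refine tsum_congr fun l => ?_
      rw [leftMulEquiv_apply, inv_mul_cancel_left' l.2.symm, inv_mul_rev l.2.symm,
        mul_assoc' (by rw [dom_inv, rng_inv, l.2]) (by rw [dom_inv, k.2])]
    rw [← h3]
    obtain ⟨k, hk⟩ := k
    dsimp only
    rw [hk]
  rw [h1, h2]
  refine Summable.tsum_comm ?_
  refine summable_of_hasFiniteSupport ?_
  refine ((hf (rng x)).biUnion (t := fun k => (fun h => (k, h)) ''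
    {h : {h : G // rng h = rng x} | g ((k : G)⁻¹ * h) ≠ 0}) fun k _ => ?_).subset ?_
  · refine Set.Finite.image _ ?_
    have : Function.Injective (fun h : {h : G // rng h = rng x} =>
        (⟨(k : G)⁻¹ * h, rng_inv_mul (k.2.trans h.2.symm)⟩ : {l : G // rng l = dom (k : G)})) := by
      intro a b hab
      have h4 : (k : G)⁻¹ * a = (k : G)⁻¹ * b := congrArg Subtype.val hab
      refine Subtype.ext ?_
      rw [← mul_inv_cancel_left' (k.2.trans a.2.symm), h4,
        mul_inv_cancel_left' (k.2.trans b.2.symm)]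
    exact (hg (dom (k : G))).preimage this.injOn
  · rintro ⟨k, h⟩ hkh
    have h5 : f k * (g ((k : G)⁻¹ * h) * ψ ((h : G)⁻¹ * x)) ≠ 0 := hkh
    exact Set.mem_biUnion (show f k ≠ 0 from left_ne_zero_of_mul h5)
      ⟨h, left_ne_zero_of_mul (right_ne_zero_of_mul h5), rfl⟩

/-- Convolution by a function supported on units is multiplication by its values. -/
theorem conv_of_support_units {f : G → ℂ} (hf : ∀ x, f x ≠ 0 → x = (rng x).arrow) (ψ : G → ℂ)
    (x : G) : conv f ψ x = f (rng x).arrow * ψ x := by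
  rw [conv, tsum_eq_single ⟨(rng x).arrow, rng_unit _⟩]
  · rw [unit_mul]
  · rintro ⟨h, hh⟩ hne
    by_contra h0
    refine hne (Subtype.ext ?_)
    exact (hf h (left_ne_zero_of_mul h0)).trans (congrArg UnitSpace.arrow hh)

theorem conv_support_units_right {ψ : G → ℂ} (hψ : ∀ x, ψ x ≠ 0 → x = (rng x).arrow) (f : G → ℂ)
    (x : G) : conv f ψ x = f x * ψ (dom x).arrow := by
  rw [conv, tsum_eq_single ⟨x, rfl⟩]
  · rfl
  · rintro ⟨h, hh⟩ hne
    by_contra h0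
    exact hne (Subtype.ext (eq_of_inv_mul_eq_arrow hh (hψ _ (right_ne_zero_of_mul h0))))

/-- Convolution by `f` of a function that factors through the range map. -/
theorem conv_comp_rng (f : G → ℂ) (η : UnitSpace G → ℂ) (x : G) :
    conv f (fun y => η (rng y)) x = ∑' h : {h : G // rng h = rng x}, f h * η (dom (h : G)) :=
  tsum_congr fun h => by simp only [rng_inv_mul h.2]

theorem conv_invol (f g : G → ℂ) (x : G) :
    conv f (invol g) x = ∑' h : {h : G // rng h = rng x}, f h * star (g (x⁻¹ * h)) :=
  tsum_congr fun h => by rw [invol, inv_mul_inv_rev h.2]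

theorem conv_eq_zero_of_left {f : G → ℂ} {x : G} (h : ∀ k, rng k = rng x → f k = 0) (ψ : G → ℂ) :
    conv f ψ x = 0 :=
  (tsum_congr fun k => by rw [h k k.2, zero_mul]).trans tsum_zero

theorem conv_eq_zero_of_right {ψ : G → ℂ} {x : G} (f : G → ℂ)
    (h : ∀ k, rng k = rng x → ψ (k⁻¹ * x) = 0) : conv f ψ x = 0 :=
  (tsum_congr fun k => by rw [h k k.2, mul_zero]).trans tsum_zero

theorem IsInvariant.rng_inv_mul_mem {D : Set (UnitSpace G)} (hD : IsInvariant D) {k x : G}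
    (hx : rng x ∈ D) (hk : rng k = rng x) : rng (k⁻¹ * x) ∈ D := by
  rw [rng_inv_mul hk]
  exact hD.dom_mem (by rwa [hk])

end GroupoidAlgebra

/-! ### Bump functions and pointwise multiplication on `C_c`. -/

section CompactSupport

variable {X : Type*} [TopologicalSpace X]

theorem exists_bump [T2Space X] [LocallyCompactSpace X] {K V : Set X} (hK : IsCompact K)
    (hV : IsOpen V) (hKV : K ⊆ V) :
    ∃ φ : C_c(X, ℂ), (∀ x ∈ K, φ x = 1) ∧ tsupport φ ⊆ V ∧ ∀ x, ‖φ x‖ ≤ 1 := by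
  obtain ⟨f, h1, h2, h3, h4⟩ := exists_continuousMap_one_of_isCompact_subset_isOpen hK hV hKV
  have hsub : Function.support (fun x => (f x : ℂ)) ⊆ Function.support f := fun x hx h0 =>
    hx (by simp [show f x = 0 from h0])
  refine ⟨⟨⟨fun x => (f x : ℂ), by fun_prop⟩, ?_⟩, ?_, ?_, ?_⟩
  · exact HasCompactSupport.of_support_subset_isCompact h2 (hsub.trans (subset_tsupport _))
  · intro x hx
    change (f x : ℂ) = 1
    rw [h1 hx]; simp
  · exact (closure_mono hsub).trans h3
  · intro x
    change ‖(f x : ℂ)‖ ≤ 1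
    rw [Complex.norm_real, Real.norm_eq_abs, abs_of_nonneg (h4 x).1]
    exact (h4 x).2

/-- A continuous function times a compactly supported one. -/
noncomputable def mulCc (a : C(X, ℂ)) (f : C_c(X, ℂ)) : C_c(X, ℂ) where
  toFun x := a x * f x
  continuous_toFun := a.continuous.mul f.continuous
  hasCompactSupport' := f.hasCompactSupport.mul_left

theorem mulCc_apply (a : C(X, ℂ)) (f : C_c(X, ℂ)) (x : X) : mulCc a f x = a x * f x := rfl

theorem mulCc_eq_zero (a : C(X, ℂ)) {f : C_c(X, ℂ)} {x : X} (h : f x = 0) : mulCc a f x = 0 := by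
  rw [mulCc_apply, h, mul_zero]

end CompactSupport

/-! ### The convolution `*`-algebra `C_c(G)`. -/

section Convolution

variable {G : Type*} [TopologicalSpace G] [ArrowGroupoid G]

instance [IsEtale G] : LocallyCompactSpace (UnitSpace G) :=
  isOpenEmbedding_arrow.locallyCompactSpace

theorem fibreFinite [IsEtale G] (f : C_c(G, ℂ)) : FibreFinite f := finite_fibre f

theorem exists_open_bisection [IsEtale G] {g : G} {W : Set G} (hW : IsOpen W) (hg : g ∈ W) :
    ∃ S, IsOpen S ∧ IsBisection S ∧ g ∈ S ∧ S ⊆ W := by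
  obtain ⟨S, hS, hx, hSW⟩ :=
    (IsEtale.isTopologicalBasis (G := G)).exists_subset_of_mem_open hg hW
  exact ⟨S, hS.1, hS.2, hx, hSW⟩

/-- A partition of unity on the compact support, subordinate to finitely many open bisections, cuts
`f` into summands each supported in one bisection. -/
theorem Cc_bisection_induction [IsEtale G] {P : C_c(G, ℂ) → Prop} (h0 : P 0)
    (hadd : ∀ f g, P f → P g → P (f + g))
    (hS : ∀ (f : C_c(G, ℂ)) S, IsOpen S → IsBisection S → tsupport f ⊆ S → P f)
    (f : C_c(G, ℂ)) : P f := by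
  classical
  choose S hSo hSb hSx _ using fun x : G =>
    exists_open_bisection (g := x) isOpen_univ (Set.mem_univ x)
  obtain ⟨t, -, ht⟩ := f.hasCompactSupport.isCompact.elim_nhds_subcover S
    (fun x _ => (hSo x).mem_nhds (hSx x))
  let e := t.equivFin.symm
  have hcov : tsupport f ⊆ ⋃ i, S (e i) := fun x hx => by
    obtain ⟨y, hy, hxy⟩ := Set.mem_iUnion₂.1 (ht hx)
    exact Set.mem_iUnion.2 ⟨e.symm ⟨y, hy⟩, by simpa using hxy⟩
  obtain ⟨p, hp1, hp2, -, -⟩ := exists_continuous_sum_one_of_isOpen_isCompact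
    (fun i => hSo (e i)) f.hasCompactSupport.isCompact hcov
  let F := fun i => mulCc ⟨fun x => (p i x : ℂ), by fun_prop⟩ f
  have hF : f = ∑ i, F i := by
    ext x
    rw [CompactlySupportedContinuousMap.sum_apply]
    by_cases hx : f x = 0
    · rw [hx]
      exact (Finset.sum_eq_zero fun i _ => mulCc_eq_zero _ hx).symm
    · have h1 := hp2 (subset_tsupport _ hx)
      simp only [Finset.sum_apply, Pi.one_apply] at h1
      change f x = ∑ i, (p i x : ℂ) * f x
      rw [← Finset.sum_mul, ← Complex.ofReal_sum, h1]; simp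
  rw [hF]
  refine Finset.sum_induction _ P hadd h0 fun i _ => hS _ (S (e i)) (hSo _) (hSb _) ?_
  refine (closure_mono fun x hx => ?_).trans (hp1 i)
  intro hpx
  apply hx
  change (p i x : ℂ) * f x = 0
  simp [hpx]

theorem conv_add_left [IsEtale G] (f g : C_c(G, ℂ)) (ψ : G → ℂ) (x : G) :
    conv (f + g : C_c(G, ℂ)) ψ x = conv f ψ x + conv g ψ x := by
  rw [conv, conv, conv, ← ((fibreFinite f).summable _ _).tsum_add ((fibreFinite g).summable _ _)]
  exact tsum_congr fun h => by
    rw [CompactlySupportedContinuousMap.add_apply, add_mul]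

/-- Over the open range of `S` the convolution sum has the single term `f (s x) * g ((s x)⁻¹ * x)`,
where `s x` is the arrow of `S` with the range of `x`; it depends continuously on `x`. At other
points the range of `x` misses the compact set `rng '' tsupport f`, so the convolution is zero
nearby. -/
theorem continuous_conv_of_bisection [IsEtale G] {f : C_c(G, ℂ)} {S : Set G}
    (hS : IsBisection S) (hf : tsupport f ⊆ S) {g : G → ℂ} (hg : Continuous g) :
    Continuous (conv f g) := by
  rw [continuous_iff_continuousAt]
  intro x₀
  by_cases hx : ∃ h ∈ S, rng h = rng x₀
  · obtain ⟨h₀, hh₀, hr₀⟩ := hx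
    have : Nonempty S := ⟨⟨h₀, hh₀⟩⟩
    let e := hS.1.toOpenPartialHomeomorph (fun g : S => (rng (g : G)).arrow)
    let O : Set G := {x | (rng x).arrow ∈ e.target}
    have he : ∀ a : S, e a = (rng (a : G)).arrow := fun _ => rfl
    have htar : e.target = Set.range (fun g : S => (rng (g : G)).arrow) := by
      simp [e]
    have hO : IsOpen O := e.open_target.preimage (continuous_arrow.comp continuous_rng)
    have hx₀ : x₀ ∈ O := by
      change (rng x₀).arrow ∈ e.target
      rw [htar]
      exact ⟨⟨h₀, hh₀⟩, congrArg UnitSpace.arrow hr₀⟩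
    let s : G → G := fun x => (e.symm (rng x).arrow : S)
    have hs : ContinuousOn s O := continuous_subtype_val.comp_continuousOn
      (e.continuousOn_symm.comp (continuous_arrow.comp continuous_rng).continuousOn fun x hx => hx)
    have hrs : ∀ x ∈ O, rng (s x) = rng x := fun x hx => by
      apply UnitSpace.arrow_injective
      exact (he _).symm.trans (e.right_inv hx)
    have key : ∀ x ∈ O, conv f g x = f (s x) * g ((s x)⁻¹ * x) := fun x hx => by
      rw [conv, tsum_eq_single ⟨s x, hrs x hx⟩]
      rintro ⟨h, hh⟩ hne
      by_contra h0
      have hhS : h ∈ S := hf (subset_tsupport _ (left_ne_zero_of_mul h0))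
      exact hne (Subtype.ext (hS.rng_inj hhS (e.symm (rng x).arrow).2 (hh.trans (hrs x hx).symm)))
    have hc : ContinuousOn (fun x => f (s x) * g ((s x)⁻¹ * x)) O := by
      refine (f.continuous.comp_continuousOn hs).mul (hg.comp_continuousOn ?_)
      exact IsEtale.continuousOn_mul.comp
        ((IsEtale.continuous_inv.comp_continuousOn hs).prodMk continuousOn_id)
        fun x hx => composable_of_rng_eq (hrs x hx)
    exact (hc.congr key).continuousAt (hO.mem_nhds hx₀)
  · have hK : IsClosed (rng '' tsupport f) :=
      (f.hasCompactSupport.isCompact.image continuous_rng).isClosed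
    have hx' : rng x₀ ∉ rng '' tsupport f := fun ⟨h, hh, hr⟩ => hx ⟨h, hf hh, hr⟩
    refine (continuousAt_const (y := (0 : ℂ))).congr ?_
    filter_upwards [(hK.isOpen_compl.preimage continuous_rng).mem_nhds hx'] with x hxx
    refine ((tsum_congr fun h => ?_).trans tsum_zero).symm
    by_contra h0
    exact hxx ⟨h, subset_tsupport _ (left_ne_zero_of_mul h0), h.2⟩

theorem continuous_conv [IsEtale G] (f : C_c(G, ℂ)) {g : G → ℂ} (hg : Continuous g) :
    Continuous (conv f g) := by
  refine Cc_bisection_induction (P := fun f => Continuous (conv f g)) ?_ ?_ ?_ f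
  · refine (continuous_const (y := (0 : ℂ))).congr fun x => ?_
    exact ((tsum_congr fun h => zero_mul _).trans tsum_zero).symm
  · intro f₁ f₂ h₁ h₂
    exact (h₁.add h₂).congr fun x => (conv_add_left f₁ f₂ g x).symm
  · exact fun f S _ hS hf => continuous_conv_of_bisection hS hf hg

theorem isClosed_composable [IsEtale G] : IsClosed {p : G × G | Composable p.1 p.2} := by
  simp only [composable_iff]
  exact isClosed_eq (continuous_dom.comp continuous_fst) (continuous_rng.comp continuous_snd)

/-- The convolution product of `C_c(G)`. -/
noncomputable def convCc [IsEtale G] (f g : C_c(G, ℂ)) : C_c(G, ℂ) where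
  toFun := conv f g
  continuous_toFun := continuous_conv f g.continuous
  hasCompactSupport' := by
    have hK : IsCompact ((fun p : G × G => p.1 * p.2) ''
        ((tsupport f ×ˢ tsupport g) ∩ {p : G × G | Composable p.1 p.2})) :=
      ((f.hasCompactSupport.isCompact.prod g.hasCompactSupport.isCompact).inter_right
        isClosed_composable).image_of_continuousOn
        (IsEtale.continuousOn_mul.mono Set.inter_subset_right)
    refine HasCompactSupport.intro hK fun x hx => ?_
    refine (tsum_congr fun h => ?_).trans tsum_zero
    by_contra h0
    refine hx ⟨(h, (h : G)⁻¹ * x), ⟨⟨subset_tsupport _ (left_ne_zero_of_mul h0),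
      subset_tsupport _ (right_ne_zero_of_mul h0)⟩, ?_⟩, mul_inv_cancel_left' h.2⟩
    exact (composable_iff _ _).2 (rng_inv_mul h.2).symm

theorem coe_convCc [IsEtale G] (f g : C_c(G, ℂ)) : ⇑(convCc f g) = conv f g := rfl

/-- The involution of `C_c(G)`. -/
noncomputable def involCc [IsEtale G] (f : C_c(G, ℂ)) : C_c(G, ℂ) where
  toFun := invol f
  continuous_toFun := continuous_star.comp (f.continuous.comp IsEtale.continuous_inv)
  hasCompactSupport' := by
    refine HasCompactSupport.intro (f.hasCompactSupport.isCompact.image IsEtale.continuous_inv)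
      fun x hx => ?_
    by_contra h0
    have h1 : f x⁻¹ ≠ 0 := fun h => h0 (by rw [invol, h, star_zero])
    exact hx ⟨x⁻¹, subset_tsupport _ h1, inv_invol x⟩

theorem coe_involCc [IsEtale G] (f : C_c(G, ℂ)) : ⇑(involCc f) = invol f := rfl

end Convolution

/-! ### The regular representation is a `*`-homomorphism; norm estimates. -/

section RegularRepresentation

variable {G : Type*} [TopologicalSpace G] [ArrowGroupoid G]

open Classical in
/-- The standard basis vectors of `ℓ²(X)`. -/
noncomputable def delta {X : Type*} (x : X) : ell2 X := lp.single 2 x (1 : ℂ)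

theorem delta_self {X : Type*} (x : X) : delta x x = 1 := by
  classical
  simp [delta]

theorem delta_of_ne {X : Type*} {x y : X} (h : y ≠ x) : delta x y = 0 := by
  classical
  simp [delta, lp.single_apply, Pi.single_eq_of_ne h]

theorem norm_delta {X : Type*} (x : X) : ‖delta x‖ = 1 := by
  classical
  rw [delta, lp.norm_single (by norm_num)]; simp

theorem inner_delta {X : Type*} (x : X) (ξ : ell2 X) : inner ℂ (delta x) ξ = ξ x := by
  classical
  rw [delta, lp.inner_single_left]; simp

theorem ell2_ext_of_delta {X Y : Type*} {S T : ell2 X →L[ℂ] ell2 Y}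
    (h : ∀ x, S (delta x) = T (delta x)) : S = T := by
  classical
  ext1 ξ
  have h1 := lp.hasSum_single (p := 2) (by norm_num) ξ
  have h2 : ∀ x, S (lp.single 2 x (ξ x)) = T (lp.single 2 x (ξ x)) := fun x => by
    have : lp.single 2 x (ξ x) = ξ x • (delta x : ell2 X) := by
      rw [delta, ← lp.single_smul, smul_eq_mul, mul_one]
    rw [this, map_smul, map_smul, h]
  have h3 := h1.mapL S
  have h4 := h1.mapL T
  simp only [h2] at h3
  exact h3.unique h4

theorem norm_coe_le {X : Type*} (ξ : ell2 X) (x : X) : ‖ξ x‖ ≤ ‖ξ‖ :=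
  lp.norm_apply_le_norm (by norm_num) ξ x

theorem star_apply_delta {X : Type*} (T : ell2 X →L[ℂ] ell2 X) (x y : X) :
    (star T) (delta x) y = star (T (delta y) x) := by
  rw [← inner_delta y, ContinuousLinearMap.star_eq_adjoint,
    ContinuousLinearMap.adjoint_inner_right, ← inner_delta x (T (delta y))]
  exact (inner_conj_symm _ _).symm

theorem regularRep_eq_conv [IsEtale G] (f : C_c(G, ℂ)) (ξ : ell2 G) :
    (regularRep f ξ : G → ℂ) = conv f ξ := rfl

theorem regularRep_ext [IsEtale G] {S T : ell2 G →L[ℂ] ell2 G} (h : ∀ ξ x, S ξ x = T ξ x) : S = T :=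
  ContinuousLinearMap.ext fun ξ => lp.ext (funext fun x => h ξ x)

theorem regularRep_convCc [IsEtale G] (f g : C_c(G, ℂ)) :
    regularRep (convCc f g) = regularRep f * regularRep g := by
  refine regularRep_ext fun ξ x => ?_
  change _ = regularRep f (regularRep g ξ) x
  rw [regularRep_eq_conv, regularRep_eq_conv, regularRep_eq_conv, coe_convCc,
    conv_assoc (fibreFinite f) (fibreFinite g)]

theorem regularRep_add [IsEtale G] (f g : C_c(G, ℂ)) :
    regularRep (f + g) = regularRep f + regularRep g :=
  regularRep_ext fun ξ x => conv_add_left f g ξ x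

theorem regularRep_smul [IsEtale G] (c : ℂ) (f : C_c(G, ℂ)) :
    regularRep (c • f) = c • regularRep f := by
  refine regularRep_ext fun ξ x => ?_
  change conv (c • f : C_c(G, ℂ)) ξ x = c * conv f ξ x
  rw [conv, conv, ← tsum_mul_left]
  exact tsum_congr fun h => by
    rw [CompactlySupportedContinuousMap.smul_apply, smul_eq_mul, mul_assoc]

theorem regularRep_zero [IsEtale G] : regularRep (0 : C_c(G, ℂ)) = 0 := by
  have := regularRep_smul (0 : ℂ) (0 : C_c(G, ℂ))
  rwa [zero_smul, zero_smul] at this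

theorem regularRep_neg [IsEtale G] (f : C_c(G, ℂ)) : regularRep (-f) = -regularRep f := by
  have := regularRep_smul (-1 : ℂ) f
  rwa [neg_one_smul, show (-1 : ℂ) • f = -f from neg_one_smul ℂ f] at this

theorem regularRep_sub [IsEtale G] (f g : C_c(G, ℂ)) :
    regularRep (f - g) = regularRep f - regularRep g := by
  rw [sub_eq_add_neg, regularRep_add, regularRep_neg, sub_eq_add_neg]

theorem regularRep_delta [IsEtale G] (f : C_c(G, ℂ)) {g x : G} (h : dom x = dom g) :
    regularRep f (delta g) x = f (x * g⁻¹) := by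
  rw [regularRep_eq_conv, conv, tsum_eq_single ⟨x * g⁻¹, rng_mul_inv h⟩]
  · dsimp only
    rw [mul_inv_inv_rev h, inv_mul_cancel_right' h.symm, delta_self, mul_one]
  · rintro ⟨k, hk⟩ hne
    rw [delta_of_ne, mul_zero]
    rintro rfl
    refine hne (Subtype.ext ?_)
    dsimp only
    rw [inv_mul_inv_rev hk, mul_inv_cancel_left' hk.symm]

theorem regularRep_delta_of_ne [IsEtale G] (f : C_c(G, ℂ)) {g x : G} (h : dom x ≠ dom g) :
    regularRep f (delta g) x = 0 := by
  rw [regularRep_eq_conv, conv]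
  refine (tsum_congr fun k => ?_).trans tsum_zero
  rw [delta_of_ne, mul_zero]
  intro hk
  exact h (by rw [← hk, dom_inv_mul k.2])

theorem regularRep_involCc [IsEtale G] (f : C_c(G, ℂ)) :
    regularRep (involCc f) = star (regularRep f) := by
  refine ell2_ext_of_delta fun g => lp.ext (funext fun x => ?_)
  rw [star_apply_delta]
  by_cases h : dom x = dom g
  · rw [regularRep_delta _ h, regularRep_delta _ h.symm, coe_involCc, invol, mul_inv_inv_rev h]
  · rw [regularRep_delta_of_ne _ h, regularRep_delta_of_ne _ (Ne.symm h), star_zero]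

/-- The operators `regularRep f`, `f ∈ C_c(G)`, form a `*`-algebra. -/
noncomputable def regularRange (G : Type*) [TopologicalSpace G] [ArrowGroupoid G] [IsEtale G] :
    NonUnitalStarSubalgebra ℂ (ell2 G →L[ℂ] ell2 G) where
  carrier := Set.range (regularRep (G := G))
  add_mem' := by rintro _ _ ⟨f, rfl⟩ ⟨g, rfl⟩; exact ⟨f + g, regularRep_add f g⟩
  zero_mem' := ⟨0, regularRep_zero⟩
  mul_mem' := by rintro _ _ ⟨f, rfl⟩ ⟨g, rfl⟩; exact ⟨convCc f g, regularRep_convCc f g⟩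
  smul_mem' := by rintro c _ ⟨f, rfl⟩; exact ⟨c • f, regularRep_smul c f⟩
  star_mem' := by rintro _ ⟨f, rfl⟩; exact ⟨involCc f, regularRep_involCc f⟩

/-- The operators `regularRep f` already form a `*`-algebra, so adjoining adds nothing before the
closure is taken. -/
theorem denseRange_toReduced [IsEtale G] : DenseRange (toReduced (G := G)) := by
  intro a
  rw [Metric.mem_closure_iff]
  intro ε hε
  have h1 : (a : ell2 G →L[ℂ] ell2 G) ∈ closure (Set.range (regularRep (G := G))) := by
    have h2 : NonUnitalStarAlgebra.adjoin ℂ (Set.range (regularRep (G := G))) ≤ regularRange G :=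
      NonUnitalStarAlgebra.adjoin_le (S := regularRange G) (le_refl _)
    exact closure_mono h2 a.2
  obtain ⟨_, ⟨f, rfl⟩, hf⟩ := Metric.mem_closure_iff.1 h1 ε hε
  exact ⟨toReduced f, ⟨f, rfl⟩, hf⟩

theorem exists_toReduced_near [IsEtale G] (a : reducedCStar G) {ε : ℝ} (hε : 0 < ε) :
    ∃ f : C_c(G, ℂ), ‖a - toReduced f‖ < ε := by
  obtain ⟨_, ⟨f, rfl⟩, hf⟩ := Metric.mem_closure_iff.1 (denseRange_toReduced a) ε hε
  exact ⟨f, by rwa [dist_eq_norm] at hf⟩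

theorem toReduced_convCc [IsEtale G] (f g : C_c(G, ℂ)) :
    toReduced (convCc f g) = toReduced f * toReduced g := Subtype.ext (regularRep_convCc f g)

theorem toReduced_add [IsEtale G] (f g : C_c(G, ℂ)) :
    toReduced (f + g) = toReduced f + toReduced g := Subtype.ext (regularRep_add f g)

theorem toReduced_sub [IsEtale G] (f g : C_c(G, ℂ)) :
    toReduced (f - g) = toReduced f - toReduced g := Subtype.ext (regularRep_sub f g)

theorem toReduced_neg [IsEtale G] (f : C_c(G, ℂ)) :
    toReduced (-f) = -toReduced f := Subtype.ext (regularRep_neg f)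

theorem toReduced_zero [IsEtale G] : toReduced (0 : C_c(G, ℂ)) = 0 := Subtype.ext regularRep_zero

theorem norm_le_of_enorm {X Y : Type*} {T : ell2 X →L[ℂ] ell2 Y} {M : ℝ} (hM : 0 ≤ M)
    (h : ∀ ξ, ∑' y, ‖T ξ y‖ₑ ^ (2 : ℝ) ≤ ENNReal.ofReal M ^ (2 : ℝ) * ∑' x, ‖ξ x‖ₑ ^ (2 : ℝ)) :
    ‖T‖ ≤ M := by
  refine ContinuousLinearMap.opNorm_le_bound _ hM fun ξ => ?_
  have h1 := h ξ
  rw [← ell2_enorm, ← ell2_enorm, ENNReal.ofReal_rpow_of_nonneg hM (by norm_num),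
    ← ENNReal.ofReal_mul (by positivity), ← Real.mul_rpow hM (norm_nonneg _),
    ENNReal.ofReal_le_ofReal_iff (by positivity)] at h1
  exact (Real.rpow_le_rpow_iff (norm_nonneg _) (by positivity) (by norm_num)).1 h1

/-- This is Schur's test. Cauchy–Schwarz with weights `‖f h‖` uses the sums over range fibres, and
the substitution `k = h⁻¹ * g` leaves sums over domain fibres. -/
theorem norm_regularRep_le [IsEtale G] (f : C_c(G, ℂ)) {M : ℝ} (hM : 0 ≤ M)
    (h1 : ∀ u, ∑' h : {h : G // rng h = u}, ‖f h‖ₑ ≤ ENNReal.ofReal M)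
    (h2 : ∀ u, ∑' h : {h : G // dom h = u}, ‖f h‖ₑ ≤ ENNReal.ofReal M) :
    ‖regularRep f‖ ≤ M := by
  refine norm_le_of_enorm hM fun ξ => ?_
  set B := ENNReal.ofReal M
  calc ∑' g, ‖∑' h : {h : G // rng h = rng g}, f h * ξ ((h : G)⁻¹ * g)‖ₑ ^ (2 : ℝ)
      ≤ ∑' g, B * ∑' h : {h : G // rng h = rng g}, ‖f h‖ₑ * ‖ξ ((h : G)⁻¹ * g)‖ₑ ^ (2 : ℝ) := by
        refine ENNReal.tsum_le_tsum fun g => ?_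
        refine (ENNReal.rpow_le_rpow enorm_tsum_le_tsum_enorm (by norm_num)).trans ?_
        simp only [enorm_mul]
        refine (weighted_cauchy _ _).trans ?_
        gcongr
        exact h1 _
    _ = B * ∑' k, ∑' h : {h : G // dom h = rng k}, ‖f h‖ₑ * ‖ξ k‖ₑ ^ (2 : ℝ) := by
        rw [ENNReal.tsum_mul_left, ← ENNReal.tsum_sigma (fun (g : G)
          (h : {h : G // rng h = rng g}) => ‖f h‖ₑ * ‖ξ ((h : G)⁻¹ * g)‖ₑ ^ (2 : ℝ)),
          ← ENNReal.tsum_sigma (fun (k : G)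
          (h : {h : G // dom h = rng k}) => ‖f h‖ₑ * ‖ξ k‖ₑ ^ (2 : ℝ)),
          ← (fibreEquiv G).tsum_eq]
        rfl
    _ ≤ B * ∑' k, B * ‖ξ k‖ₑ ^ (2 : ℝ) := by
        gcongr with k
        rw [ENNReal.tsum_mul_right]
        gcongr
        exact h2 _
    _ = _ := by
        rw [ENNReal.tsum_mul_left, ← mul_assoc]
        congr 1
        rw [ENNReal.rpow_two, sq]

/-- On functions supported in a fixed compact set the reduced norm is dominated by a multiple of
the supremum norm. -/
theorem exists_norm_regularRep_le [IsEtale G] {K : Set G} (hK : IsCompact K) :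
    ∃ N : ℝ, 0 ≤ N ∧ ∀ (f : C_c(G, ℂ)) (c : ℝ), 0 ≤ c → (∀ x, f x ≠ 0 → x ∈ K) →
      (∀ x, ‖f x‖ ≤ c) → ‖regularRep f‖ ≤ N * c := by
  -- Every admissible `f` satisfies `‖f‖ ≤ c * ‖φ‖` pointwise, so the fibre bound of this one bump
  -- serves for all of them.
  obtain ⟨φ, hφ, -, -⟩ := exists_bump hK isOpen_univ (Set.subset_univ _)
  obtain ⟨M, hM, h1, h2⟩ := exists_fibre_bound φ
  refine ⟨M, hM, fun f c hc hfK hfc => ?_⟩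
  have hle : ∀ x, ‖f x‖ₑ ≤ ‖φ x‖ₑ * ENNReal.ofReal c := fun x => by
    by_cases hx : f x = 0
    · simp [hx]
    · rw [hφ x (hfK x hx), enorm_one, one_mul, ← ofReal_norm]
      exact ENNReal.ofReal_le_ofReal (hfc x)
  refine norm_regularRep_le f (by positivity) (fun u => ?_) (fun u => ?_)
  · refine (ENNReal.tsum_le_tsum fun h => hle _).trans ?_
    rw [ENNReal.tsum_mul_right, ENNReal.ofReal_mul hM]
    gcongr
    exact h1 u
  · refine (ENNReal.tsum_le_tsum fun h => hle _).trans ?_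
    rw [ENNReal.tsum_mul_right, ENNReal.ofReal_mul hM]
    gcongr
    exact h2 u

end RegularRepresentation

/-! ### Elements of the reduced algebra as continuous functions on `G`. -/

section Coefficients

variable {G : Type*} [TopologicalSpace G] [ArrowGroupoid G] [IsEtale G]

theorem continuous_eval (ξ : ell2 G) (x : G) :
    Continuous fun a : reducedCStar G => (a : ell2 G →L[ℂ] ell2 G) ξ x := by
  have h : Continuous fun η : ell2 G => η x := by
    refine (LipschitzWith.of_dist_le_mul (K := 1) fun η ζ => ?_).continuous
    rw [dist_eq_norm, dist_eq_norm, NNReal.coe_one, one_mul]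
    exact norm_coe_le (η - ζ) x
  exact h.comp ((ContinuousLinearMap.apply ℂ (ell2 G) ξ).continuous.comp continuous_subtype_val)

/-- The function on `G` that corresponds to an element of `C_r^*(G)`. -/
noncomputable def coef (a : reducedCStar G) (x : G) : ℂ :=
  (a : ell2 G →L[ℂ] ell2 G) (delta (dom x).arrow) x

theorem coef_toReduced (f : C_c(G, ℂ)) (x : G) : coef (toReduced f) x = f x := by
  change regularRep f _ x = _
  rw [regularRep_delta f (dom_unit _).symm, arrow_inv, mul_arrow rfl]

theorem coef_sub (a b : reducedCStar G) (x : G) : coef (a - b) x = coef a x - coef b x := rfl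

theorem norm_coef_le (a : reducedCStar G) (x : G) : ‖coef a x‖ ≤ ‖a‖ := by
  refine (norm_coe_le _ x).trans ((ContinuousLinearMap.le_opNorm _ _).trans ?_)
  rw [norm_delta, mul_one]
  rfl

theorem continuous_coef_left (x : G) : Continuous fun a : reducedCStar G => coef a x :=
  continuous_eval _ _

/-- By `norm_coef_le`, norm approximation of `a` by elements of `C_c(G)` is uniform approximation of
`coef a`. -/
theorem continuous_coef (a : reducedCStar G) : Continuous (coef a) := by
  refine continuous_of_uniform_approx_of_continuous fun u hu => ?_
  obtain ⟨ε, hε, hu⟩ := Metric.mem_uniformity_dist.1 hu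
  obtain ⟨f, hf⟩ := exists_toReduced_near a hε
  refine ⟨f, f.continuous, fun x => hu ?_⟩
  rw [dist_eq_norm, ← coef_toReduced, ← coef_sub]
  exact (norm_coef_le _ x).trans_lt hf

/-- The relation holds on `C_c(G)` and survives norm limits. With `apply_delta_of_ne` it expresses
all matrix entries of `a` through `coef a`. -/
theorem apply_delta (a : reducedCStar G) {g x : G} (h : dom x = dom g) :
    (a : ell2 G →L[ℂ] ell2 G) (delta g) x = coef a (x * g⁻¹) := by
  refine denseRange_toReduced.induction_on a
    (isClosed_eq (continuous_eval _ _) (continuous_coef_left _)) fun f => ?_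
  rw [coef_toReduced]
  exact regularRep_delta f h

theorem apply_delta_of_ne (a : reducedCStar G) {g x : G} (h : dom x ≠ dom g) :
    (a : ell2 G →L[ℂ] ell2 G) (delta g) x = 0 := by
  refine denseRange_toReduced.induction_on a
    (isClosed_eq (continuous_eval _ _) continuous_const) fun f => ?_
  exact regularRep_delta_of_ne f h

theorem eq_zero_of_coef (a : reducedCStar G) (h : ∀ x, coef a x = 0) : a = 0 := by
  refine Subtype.ext (ell2_ext_of_delta fun g => lp.ext (funext fun x => ?_))
  by_cases hx : dom x = dom g
  · rw [apply_delta a hx, h]; rfl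
  · rw [apply_delta_of_ne a hx]; rfl

/-- The coefficient of `star a * a` at the unit `u` is the squared norm of the image of `delta
u.arrow` under `a`. -/
theorem apply_delta_eq_zero_of_coef_star_mul (a : reducedCStar G) (u : UnitSpace G)
    (h : coef (star a * a) u.arrow = 0) : (a : ell2 G →L[ℂ] ell2 G) (delta u.arrow) = 0 := by
  rw [coef, dom_unit, ← inner_delta] at h
  change inner ℂ _ ((star (a : ell2 G →L[ℂ] ell2 G)) ((a : ell2 G →L[ℂ] ell2 G) _)) = 0 at h
  rw [ContinuousLinearMap.star_eq_adjoint, ContinuousLinearMap.adjoint_inner_right] at h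
  exact inner_self_eq_zero.1 h

end Coefficients

/-! ### Products `f * f'^*` of functions supported in a bisection. -/

section BisectionProducts

variable {G : Type*} [ArrowGroupoid G]

theorem conv_invol_arrow (f f' : G → ℂ) (u : UnitSpace G) :
    conv f (invol f') u.arrow = ∑' h : {h : G // rng h = u}, f h * star (f' h) := by
  rw [conv_invol]
  have : ∀ v, v = u → (∑' h : {h : G // rng h = v}, f h * star (f' (u.arrow⁻¹ * h))) =
      ∑' h : {h : G // rng h = u}, f h * star (f' h) := by
    rintro _ rfl
    exact tsum_congr fun h => by rw [arrow_inv, arrow_mul h.2.symm]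
  exact this _ (rng_unit u)

variable [TopologicalSpace G]

/-- If `f` and `f'` are supported in a bisection, then `f * f'^*` is supported on units. -/
theorem conv_invol_support {S : Set G} (hS : IsBisection S) {f f' : G → ℂ}
    (hf : ∀ x, f x ≠ 0 → x ∈ S) (hf' : ∀ x, f' x ≠ 0 → x ∈ S) (x : G)
    (hx : conv f (invol f') x ≠ 0) : x = (rng x).arrow := by
  rw [conv_invol] at hx
  obtain ⟨h, hh⟩ := not_forall.1 fun h0 => hx ((tsum_congr h0).trans tsum_zero)
  have h1 : f' (x⁻¹ * h) ≠ 0 := fun h0 => hh (by rw [h0, star_zero, mul_zero])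
  have h2 := hS.dom_inj (hf' _ h1) (hf _ (left_ne_zero_of_mul hh)) (dom_inv_mul h.2.symm)
  have h3 := eq_arrow_of_mul_left (by rw [dom_inv, h.2]) h2
  have h4 := congrArg (·⁻¹) h3
  simp only [inv_invol, arrow_inv] at h4
  rwa [h.2] at h4

theorem conv_invol_rng {S : Set G} (hS : IsBisection S) {f f' : G → ℂ}
    (hf : ∀ x, f x ≠ 0 → x ∈ S) {g : G} (hg : g ∈ S) :
    conv f (invol f') (rng g).arrow = f g * star (f' g) := by
  rw [conv_invol_arrow, tsum_eq_single ⟨g, rfl⟩]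
  rintro ⟨h, hh⟩ hne
  by_contra h0
  exact hne (Subtype.ext (hS.rng_inj (hf _ (left_ne_zero_of_mul h0)) hg hh))

end BisectionProducts

/-! ### Functions on the unit space and supports of ideals. -/

section Units

variable {G : Type*} [TopologicalSpace G] [ArrowGroupoid G] [IsEtale G]

theorem isClosedEmbedding_arrow : Topology.IsClosedEmbedding (UnitSpace.arrow (G := G)) := by
  refine ⟨isOpenEmbedding_arrow.isEmbedding, ?_⟩
  have : Set.range (UnitSpace.arrow (G := G)) = {g | (rng g).arrow = g} := by
    ext g
    refine ⟨?_, fun h => ⟨_, h⟩⟩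
    rintro ⟨u, rfl⟩
    exact congrArg UnitSpace.arrow (rng_unit u)
  rw [this]
  exact isClosed_eq (continuous_arrow.comp continuous_rng) continuous_id

/-- Extension by zero of a function on the unit space. -/
noncomputable abbrev unitExt (φ : C_c(UnitSpace G, ℂ)) : C_c(G, ℂ) :=
  extendCc isOpenEmbedding_arrow φ

theorem unitExt_arrow (φ : C_c(UnitSpace G, ℂ)) (u : UnitSpace G) : unitExt φ u.arrow = φ u :=
  extendCc_apply _ _ _

theorem unitExt_support (φ : C_c(UnitSpace G, ℂ)) (x : G) (h : unitExt φ x ≠ 0) :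
    x = (rng x).arrow := by
  by_contra h0
  refine h (extendCc_apply_of_notMem _ _ ?_)
  rintro ⟨u, rfl⟩
  exact h0 (by rw [rng_unit])

/-- Restriction of a function to the unit space. -/
noncomputable abbrev unitRestr (f : C_c(G, ℂ)) : C_c(UnitSpace G, ℂ) :=
  restrictCc isClosedEmbedding_arrow f

theorem unitExt_unitRestr {f : C_c(G, ℂ)} (hf : ∀ x, f x ≠ 0 → x = (rng x).arrow) :
    unitExt (unitRestr f) = f := by
  ext x
  by_cases hx : x = (rng x).arrow
  · rw [hx, unitExt_arrow]; rfl
  · have h1 : f x = 0 := by_contra fun h => hx (hf x h)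
    rw [h1]
    by_contra h
    exact hx (unitExt_support _ x h)

theorem conv_unitExt (φ : C_c(UnitSpace G, ℂ)) (ψ : G → ℂ) (x : G) :
    conv (unitExt φ) ψ x = φ (rng x) * ψ x := by
  rw [conv_of_support_units (unitExt_support φ), unitExt_arrow]

theorem conv_unitExt_right (φ : C_c(UnitSpace G, ℂ)) (f : G → ℂ) (x : G) :
    conv f (unitExt φ) x = f x * φ (dom x) := by
  rw [conv_support_units_right (unitExt_support φ), unitExt_arrow]

theorem norm_unitExt_le (φ : C_c(UnitSpace G, ℂ)) {c : ℝ} (hc : 0 ≤ c) (h : ∀ u, ‖φ u‖ ≤ c) :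
    ‖toReduced (unitExt φ)‖ ≤ c := by
  refine ContinuousLinearMap.opNorm_le_bound _ hc fun ξ => ell2_norm_le hc fun x => ?_
  change ‖conv (unitExt φ) ξ x‖ ≤ _
  rw [conv_unitExt, norm_mul]
  exact mul_le_mul_of_nonneg_right (h _) (norm_nonneg _)

theorem convCc_unitExt_unitExt (φ ψ : C_c(UnitSpace G, ℂ)) :
    convCc (unitExt φ) (unitExt ψ) = unitExt (φ * ψ) := by
  ext x
  rw [coe_convCc, conv_unitExt]
  by_cases hx : x = (rng x).arrow
  · rw [hx, unitExt_arrow, unitExt_arrow, rng_unit]; rfl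
  · have h : ∀ χ : C_c(UnitSpace G, ℂ), unitExt χ x = 0 := fun χ => by
      by_contra h
      exact hx (unitExt_support _ x h)
    rw [h, h, mul_zero]

/-- A compactly supported function, as a function that vanishes at infinity. -/
def toC0 (φ : C_c(UnitSpace G, ℂ)) : C₀(UnitSpace G, ℂ) :=
  ⟨φ.toContinuousMap, φ.hasCompactSupport.is_zero_at_infty⟩

theorem diag_toC0 (φ : C_c(UnitSpace G, ℂ)) : diag (toC0 φ) = toReduced (unitExt φ) := by
  refine Subtype.ext (regularRep_ext fun ξ x => ?_)
  exact (conv_unitExt φ ξ x).symm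

theorem toReduced_unitExt_mul_diag (φ ψ : C_c(UnitSpace G, ℂ)) (χ : C₀(UnitSpace G, ℂ))
    (h : ∀ u, φ u = ψ u * χ u) :
    toReduced (unitExt φ) = toReduced (unitExt ψ) * diag χ := by
  refine Subtype.ext (regularRep_ext fun ξ x => ?_)
  change conv (unitExt φ) ξ x = conv (unitExt ψ) (diagOp χ ξ) x
  rw [conv_unitExt, conv_unitExt, h, diagOp_apply, mul_assoc]

/-- Multiplying an element of `C₀` in the ideal by a bump at `u` keeps it in the ideal and makes its
support compact, so `C_c` functions suffice to detect the support. -/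
theorem mem_idealSupport_iff (I : ClosedIdeal G) (u : UnitSpace G) :
    u ∈ idealSupport I ↔ ∃ φ : C_c(UnitSpace G, ℂ), toReduced (unitExt φ) ∈ I.1 ∧ φ u ≠ 0 := by
  constructor
  · rintro ⟨χ, hχ, hu⟩
    obtain ⟨ψ, hψ, -, -⟩ := exists_bump (isCompact_singleton (x := u)) isOpen_univ
      (Set.subset_univ _)
    have hψu : ψ u = 1 := hψ u rfl
    refine ⟨mulCc ⟨χ, χ.continuous⟩ ψ, ?_, ?_⟩
    · rw [toReduced_unitExt_mul_diag _ ψ χ fun v => mul_comm _ _]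
      exact I.1.mul_mem_left _ _ hχ
    · rw [mulCc_apply, hψu, mul_one]
      exact hu
  · rintro ⟨φ, hφ, hu⟩
    exact ⟨toC0 φ, by rwa [diag_toC0], hu⟩

theorem isOpen_idealSupport (I : ClosedIdeal G) : IsOpen (idealSupport I) := by
  have : idealSupport I = ⋃ f : {f : C₀(UnitSpace G, ℂ) // diag f ∈ I.1}, {u | f.1 u ≠ 0} := by
    ext u
    simp [idealSupport]
  rw [this]
  exact isOpen_iUnion fun f => isOpen_ne_fun f.1.continuous continuous_const

/-- For a bump `f` with `f g = 1` in a bisection around `g`, the conjugate `f * φ * f^*` stays in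
the ideal, is supported on units, and takes at `rng g` the value of `φ` at `dom g`. -/
theorem isInvariant_idealSupport (I : ClosedIdeal G) : IsInvariant (idealSupport I) := by
  intro g hg
  obtain ⟨φ, hφ, hu⟩ := (mem_idealSupport_iff I _).1 hg
  obtain ⟨S, hSo, hS, hgS, -⟩ := exists_open_bisection (g := g) isOpen_univ (Set.mem_univ g)
  obtain ⟨f, hf1, hfS, -⟩ := exists_bump (isCompact_singleton (x := g)) hSo
    (Set.singleton_subset_iff.2 hgS)
  have hfg : f g = 1 := hf1 g rfl
  have hfS' : ∀ x, f x ≠ 0 → x ∈ S := fun x hx => hfS (subset_tsupport _ hx)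
  have hfφ : ∀ x, convCc f (unitExt φ) x ≠ 0 → x ∈ S := fun x hx => by
    rw [coe_convCc, conv_unitExt_right] at hx
    exact hfS' x (left_ne_zero_of_mul hx)
  have hk := conv_invol_support hS hfφ hfS'
  refine (mem_idealSupport_iff I _).2
    ⟨unitRestr (convCc (convCc f (unitExt φ)) (involCc f)), ?_, ?_⟩
  · rw [unitExt_unitRestr hk, toReduced_convCc, toReduced_convCc]
    exact I.1.mul_mem_right _ _ (I.1.mul_mem_left _ _ hφ)
  · change conv (convCc f (unitExt φ)) (invol f) (rng g).arrow ≠ 0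
    rw [conv_invol_rng hS hfφ hgS, coe_convCc, conv_unitExt_right, hfg]
    simpa using hu

end Units

/-! ### Recovering a closed ideal from its support. -/

section ClosedIdeals

variable {G : Type*} [TopologicalSpace G] [ArrowGroupoid G]

/-- A unit of `D` has the same isotropy group in `G` as in `Restr D`, so the dense set provided by
essential principality can be used for a continuous function on `G`. -/
theorem dense_trivial_isotropy (hG : EssentiallyPrincipal G) {D : Set (UnitSpace G)}
    (hD : IsClosed D) (hinv : IsInvariant D) {F : G → ℂ} (hF : Continuous F)
    (h : ∀ u ∈ D, (∀ g, dom g = u → rng g = u → g = u.arrow) → F u.arrow = 0)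
    {u : UnitSpace G} (hu : u ∈ D) : F u.arrow = 0 := by
  have hdense := hG D hD hinv
  have hcl : IsClosed {v : UnitSpace (Restr D) | F v.arrow.incl = 0} :=
    isClosed_eq (hF.comp ((continuous_incl D).comp continuous_arrow)) continuous_const
  have hsub : {v : UnitSpace (Restr D) | {g : Restr D | dom g = v ∧ rng g = v} = {v.arrow}} ⊆
      {v : UnitSpace (Restr D) | F v.arrow.incl = 0} := by
    intro v hv
    have h1 : v.arrow.incl = (rng v.arrow.incl).arrow := by
      rw [← Restr.incl_rng, rng_unit]
    change F v.arrow.incl = 0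
    rw [h1]
    refine h _ v.arrow.2.2 fun g hd hr => ?_
    have hgD : rng g ∈ D := by rw [hr]; exact v.arrow.2.2
    have hgD' : dom g ∈ D := by rw [hd]; exact v.arrow.2.2
    have h2 : Restr.of g hgD' hgD ∈ {g : Restr D | dom g = v ∧ rng g = v} := by
      constructor
      · refine UnitSpace.arrow_injective (Restr.incl_injective ?_)
        rw [Restr.incl_dom, Restr.incl_of, hd, ← h1]
      · refine UnitSpace.arrow_injective (Restr.incl_injective ?_)
        rw [Restr.incl_rng, Restr.incl_of, hr, ← h1]
    have hv' : {g : Restr D | dom g = v ∧ rng g = v} = {v.arrow} := hv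
    rw [hv'] at h2
    rw [← h1]
    exact congrArg Restr.incl (Set.mem_singleton_iff.1 h2)
  have hall := hcl.closure_subset_iff.2 hsub
  have hud : dom u.arrow ∈ D := by rwa [dom_unit]
  have hur : rng u.arrow ∈ D := by rwa [rng_unit]
  have h3 := hall (hdense (rng (Restr.of u.arrow hud hur)))
  rw [Set.mem_ofPred_eq, Restr.incl_rng, Restr.incl_of, rng_unit] at h3
  exact h3

variable [IsEtale G]

theorem ClosedIdeal.mem_of_approx (I : ClosedIdeal G) {a : reducedCStar G}
    (h : ∀ ε > 0, ∃ b ∈ I.1, ‖a - b‖ < ε) : a ∈ I.1 := by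
  have h1 : a ∈ closure {a | a ∈ I.1} := Metric.mem_closure_iff.2 fun ε hε => by
    obtain ⟨b, hb, hlt⟩ := h ε hε
    exact ⟨b, hb, by rwa [dist_eq_norm]⟩
  rwa [I.2.closure_eq] at h1

/-- If `k` acts as a right unit on `m` and has distance less than one to a closed ideal, then `m`
lies in the ideal. -/
theorem ClosedIdeal.mem_of_mul_eq (I : ClosedIdeal G) {m k x : reducedCStar G} (hx : x ∈ I.1)
    (hmk : m * k = m) (hlt : ‖k - x‖ < 1) : m ∈ I.1 := by
  -- The witness is `m (k - x) ^ n`: modulo the ideal, right multiplication by `k - x` agrees with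
  -- right multiplication by `k`, which fixes `m`.
  have h : ∀ n : ℕ, ∃ z, m - z ∈ I.1 ∧ ‖z‖ ≤ ‖m‖ * ‖k - x‖ ^ n := by
    intro n
    induction n with
    | zero => exact ⟨m, by rw [sub_self]; exact I.1.zero_mem, by simp⟩
    | succ n ih =>
      obtain ⟨z, hz, hzn⟩ := ih
      refine ⟨z * (k - x), ?_, ?_⟩
      · have : m - z * (k - x) = (m - z) * (k - x) + m * x := by
          rw [sub_mul, mul_sub m, hmk]; abel
        rw [this]
        exact I.1.add_mem (I.1.mul_mem_right _ _ hz) (I.1.mul_mem_left _ _ hx)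
      · rw [pow_succ, ← mul_assoc]
        exact (norm_mul_le _ _).trans (mul_le_mul_of_nonneg_right hzn (norm_nonneg _))
  refine I.mem_of_approx fun ε hε => ?_
  have ht : Filter.Tendsto (fun n : ℕ => ‖m‖ * ‖k - x‖ ^ n) Filter.atTop (nhds 0) := by
    simpa using (tendsto_pow_atTop_nhds_zero_of_lt_one (norm_nonneg _) hlt).const_mul ‖m‖
  obtain ⟨n, hn⟩ := (ht.eventually_lt_const hε).exists
  obtain ⟨z, hz, hzn⟩ := h n
  exact ⟨m - z, hz, by rw [sub_sub_cancel]; exact hzn.trans_lt hn⟩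

/-- A bump equal to one on the support of `φ` replaces `a` by a compactly supported function, which
defines an element of the algebra. -/
theorem ClosedIdeal.mulCc_mem (I : ClosedIdeal G) (a : C(UnitSpace G, ℂ))
    {φ : C_c(UnitSpace G, ℂ)} (h : toReduced (unitExt φ) ∈ I.1) :
    toReduced (unitExt (mulCc a φ)) ∈ I.1 := by
  obtain ⟨χ, hχ, -, -⟩ := exists_bump φ.hasCompactSupport.isCompact isOpen_univ
    (Set.subset_univ _)
  have h1 : mulCc a φ = mulCc a χ * φ := by
    ext u
    change a u * φ u = a u * χ u * φ u
    by_cases hu : φ u = 0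
    · simp [hu]
    · rw [hχ u (subset_tsupport _ hu), mul_one]
  rw [h1, ← convCc_unitExt_unitExt, toReduced_convCc]
  exact I.1.mul_mem_left _ _ h

theorem norm_div_max_le {c : ℝ} (hc : 0 < c) (t : ℝ) (ht : 0 ≤ t) :
    t / max (t ^ 2) (c ^ 2 / 4) ≤ 2 / c := by
  have hpos : 0 < max (t ^ 2) (c ^ 2 / 4) := lt_max_of_lt_right (by positivity)
  rw [div_le_div_iff₀ hpos hc]
  rcases le_total (c / 2) t with h | h
  · nlinarith [le_max_left (t ^ 2) (c ^ 2 / 4)]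
  · nlinarith [le_max_right (t ^ 2) (c ^ 2 / 4)]

/-- A unit with trivial isotropy at which some element of a closed ideal does not vanish belongs
to the support of the ideal. -/
theorem mem_idealSupport_of_coef_ne_zero (I : ClosedIdeal G) {a : reducedCStar G} (ha : a ∈ I.1)
    {u : UnitSpace G} (hu : ∀ g, dom g = u → rng g = u → g = u.arrow)
    (h : coef a u.arrow ≠ 0) : u ∈ idealSupport I := by
  set c := ‖coef a u.arrow‖
  have hc : 0 < c := norm_pos_iff.2 h
  -- The error `c / 4` keeps `‖f u.arrow‖` above `c / 2`, and multiplied by the bound `2 / c` for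
  -- `l` below it gives `1 / 2 < 1`.
  obtain ⟨f, hf⟩ := exists_toReduced_near a (ε := c / 4) (by positivity)
  have hfu : c / 2 < ‖f u.arrow‖ := by
    have h1 := (norm_coef_le (a - toReduced f) u.arrow).trans_lt hf
    rw [coef_sub, coef_toReduced] at h1
    have h2 := norm_sub_norm_le (coef a u.arrow) (f u.arrow)
    change c - _ ≤ _ at h2
    linarith
  -- The units are open, so the non-unit part of the support is compact and its image under `(rng,
  -- dom)` is closed. Trivial isotropy keeps `(u, u)` out of that image, hence a product
  -- neighbourhood `V₁ ×ˢ V₂` avoids it.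
  have hK : IsCompact (tsupport f \ Set.range (UnitSpace.arrow (G := G))) :=
    f.hasCompactSupport.isCompact.diff isOpenEmbedding_arrow.isOpen_range
  have hP := (hK.image (continuous_rng.prodMk continuous_dom)).isClosed
  have huP : (u, u) ∉ (fun g : G => (rng g, dom g)) ''
      (tsupport f \ Set.range (UnitSpace.arrow (G := G))) := by
    rintro ⟨g, ⟨-, hg⟩, hgu⟩
    rw [Prod.mk.injEq] at hgu
    exact hg ⟨u, (hu g hgu.2 hgu.1).symm⟩
  obtain ⟨V₁, V₂, hV₁, hV₂, hu₁, hu₂, hVP⟩ := isOpen_prod_iff.1 hP.isOpen_compl u u huP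
  have hV₃ : IsOpen {v : UnitSpace G | c / 2 < ‖f v.arrow‖} :=
    isOpen_lt continuous_const (f.continuous.comp continuous_arrow).norm
  obtain ⟨L, hL, huL, hLV⟩ := exists_compact_subset ((hV₁.inter hV₂).inter hV₃)
    (show u ∈ V₁ ∩ V₂ ∩ {v | c / 2 < ‖f v.arrow‖} from ⟨⟨hu₁, hu₂⟩, hfu⟩)
  obtain ⟨b, hb1, hbV, hb⟩ := exists_bump hL ((hV₁.inter hV₂).inter hV₃) hLV
  obtain ⟨m, hm1, hmL, -⟩ := exists_bump (isCompact_singleton (x := u)) isOpen_interior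
    (Set.singleton_subset_iff.2 huL)
  have hbV' : ∀ v, b v ≠ 0 → v ∈ V₁ ∩ V₂ ∩ {v | c / 2 < ‖f v.arrow‖} := fun v hv =>
    hbV (subset_tsupport _ hv)
  have hpos : ∀ v : UnitSpace G, 0 < max (‖f v.arrow‖ ^ 2) (c ^ 2 / 4) := fun v =>
    lt_max_of_lt_right (by positivity)
  -- Where `‖f v.arrow‖ > c / 2` this is the inverse of `f v.arrow`; the maximum makes it continuous
  -- and bounded by `2 / c` everywhere.
  let q : C(UnitSpace G, ℂ) :=
    ⟨fun v => star (f v.arrow) / ((max (‖f v.arrow‖ ^ 2) (c ^ 2 / 4) : ℝ) : ℂ), by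
      have h1 : Continuous fun v : UnitSpace G => f v.arrow := f.continuous.comp continuous_arrow
      refine (continuous_star.comp h1).div (Complex.continuous_ofReal.comp (by fun_prop))
        fun v => ?_
      exact_mod_cast (hpos v).ne'⟩
  have hq : ∀ v, ‖q v‖ ≤ 2 / c := fun v => by
    change ‖star (f v.arrow) / ((max (‖f v.arrow‖ ^ 2) (c ^ 2 / 4) : ℝ) : ℂ)‖ ≤ _
    rw [norm_div, norm_star, Complex.norm_real, Real.norm_of_nonneg (hpos v).le]
    exact norm_div_max_le hc _ (norm_nonneg _)
  let l := mulCc q b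
  have hl : ∀ v, ‖l v‖ ≤ 2 / c := fun v => by
    rw [mulCc_apply, norm_mul]
    exact (mul_le_mul (hq v) (hb v) (norm_nonneg _) (by positivity)).trans_eq (mul_one _)
  -- Multiplying by `l` on the left and `b` on the right restricts `f` to arrows with range and
  -- domain in `V₁ ∩ V₂`; of its support only units remain there, and on them `q` cancels `f`.
  have hprod : convCc (convCc (unitExt l) f) (unitExt b) = unitExt (b * b) := by
    ext x
    rw [coe_convCc, conv_unitExt_right, coe_convCc, conv_unitExt]
    by_cases hx : x = (rng x).arrow
    · have hd : dom x = rng x := by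
        conv_lhs => rw [hx, dom_unit]
      rw [hd]
      conv_rhs => rw [hx, unitExt_arrow]
      conv_lhs => rw [hx, rng_unit]
      rw [CompactlySupportedContinuousMap.mul_apply]
      congr 1
      by_cases hbx : b (rng x) = 0
      · rw [mulCc_eq_zero _ hbx, zero_mul, hbx]
      · have h1 : c / 2 < ‖f (rng x).arrow‖ := (hbV' _ hbx).2
        have h2 : max (‖f (rng x).arrow‖ ^ 2) (c ^ 2 / 4) = ‖f (rng x).arrow‖ ^ 2 :=
          max_eq_left (by nlinarith)
        have h3 : (‖f (rng x).arrow‖ : ℂ) ≠ 0 := by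
          exact_mod_cast (by positivity : 0 < c / 2).trans h1 |>.ne'
        change star (f (rng x).arrow) / ((max (‖f (rng x).arrow‖ ^ 2) (c ^ 2 / 4) : ℝ) : ℂ) *
          b (rng x) * f (rng x).arrow = _
        rw [h2, mul_right_comm, div_mul_eq_mul_div, mul_comm (star _)]
        change f (rng x).arrow * (starRingEnd ℂ) _ / _ * _ = _
        rw [Complex.mul_conj']
        push_cast
        rw [div_self (pow_ne_zero 2 h3), one_mul]
    · have h1 : unitExt (b * b) x = 0 := by
        by_contra h0
        exact hx (unitExt_support _ x h0)
      rw [h1]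
      by_contra h0
      have hbr : b (rng x) ≠ 0 := fun h2 => h0 (by
        rw [show l (rng x) = 0 from mulCc_eq_zero _ h2, zero_mul, zero_mul])
      refine hVP (show (rng x, dom x) ∈ V₁ ×ˢ V₂ from ⟨(hbV' _ hbr).1.1,
        (hbV' _ (right_ne_zero_of_mul h0)).1.2⟩) ⟨x, ⟨?_, ?_⟩, rfl⟩
      · exact subset_tsupport _ (right_ne_zero_of_mul (left_ne_zero_of_mul h0))
      · rintro ⟨v, rfl⟩
        exact hx (by rw [rng_unit])
  refine (mem_idealSupport_iff I u).2 ⟨m, ?_, by rw [hm1 u rfl]; exact one_ne_zero⟩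
  refine I.mem_of_mul_eq (k := toReduced (unitExt (b * b)))
    (x := toReduced (unitExt l) * a * toReduced (unitExt b))
    (I.1.mul_mem_right _ _ (I.1.mul_mem_left _ _ ha)) ?_ ?_
  · rw [← toReduced_convCc, convCc_unitExt_unitExt]
    congr 2
    ext v
    rw [CompactlySupportedContinuousMap.mul_apply, CompactlySupportedContinuousMap.mul_apply]
    by_cases hv : m v = 0
    · rw [hv, zero_mul]
    · rw [hb1 v (interior_subset (hmL (subset_tsupport _ hv))), mul_one, mul_one]
  · rw [← hprod, toReduced_convCc, toReduced_convCc, ← sub_mul, ← mul_sub]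
    have h1 := norm_unitExt_le l (by positivity) hl
    have h2 := norm_unitExt_le b zero_le_one hb
    have h3 : ‖toReduced f - a‖ ≤ c / 4 := by rw [norm_sub_rev]; exact hf.le
    calc _ ≤ ‖toReduced (unitExt l)‖ * ‖toReduced f - a‖ * ‖toReduced (unitExt b)‖ :=
          (norm_mul_le _ _).trans (mul_le_mul_of_nonneg_right (norm_mul_le _ _) (norm_nonneg _))
      _ ≤ 2 / c * (c / 4) * 1 := by gcongr
      _ < 1 := by
        rw [mul_one, div_mul_div_comm, mul_comm 2 c, mul_div_mul_left _ _ hc.ne']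
        norm_num

/-- In an essentially principal groupoid the elements of a closed ideal vanish over the complement
of its support. -/
theorem coef_eq_zero_of_mem (hG : EssentiallyPrincipal G) (I : ClosedIdeal G) {a : reducedCStar G}
    (ha : a ∈ I.1) {x : G} (hx : rng x ∉ idealSupport I) : coef a x = 0 := by
  have hu : dom x ∈ (idealSupport I)ᶜ := fun h => hx (isInvariant_idealSupport I x h)
  -- The density argument reaches only values at units. Applying it to `star a * a` controls the
  -- whole vector `a δ` at the unit `dom x`, and so the value at `x`.
  have h1 : coef (star a * a) (dom x).arrow = 0 :=
    dense_trivial_isotropy hG (isOpen_idealSupport I).isClosed_compl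
      (isInvariant_idealSupport I).compl (continuous_coef _)
      (fun u hu htriv => by
        by_contra h0
        exact hu (mem_idealSupport_of_coef_ne_zero I (I.1.mul_mem_left _ _ ha) htriv h0)) hu
  rw [coef, apply_delta_eq_zero_of_coef_star_mul a _ h1]
  rfl

/-- Functions `star φ * φ` in the ideal are nonnegative, so finitely many can be added without
cancellation to get `ψ > 0` on `L`. Dividing `ψ` by `max ‖ψ‖ δ`, with `δ` a positive lower bound of
`ψ` on `L`, gives the value one there. -/
theorem ClosedIdeal.exists_one_on_compact (I : ClosedIdeal G) {L : Set (UnitSpace G)}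
    (hL : IsCompact L) (hLI : L ⊆ idealSupport I) :
    ∃ φ : C_c(UnitSpace G, ℂ), toReduced (unitExt φ) ∈ I.1 ∧ (∀ u ∈ L, φ u = 1) ∧
      ∀ u, ‖φ u‖ ≤ 1 := by
  have hpos : ∃ ψ : C_c(UnitSpace G, ℂ), toReduced (unitExt ψ) ∈ I.1 ∧
      (∀ u, ψ u = (‖ψ u‖ : ℂ)) ∧ ∀ u ∈ L, ψ u ≠ 0 := by
    have hzero : toReduced (unitExt (0 : C_c(UnitSpace G, ℂ))) = 0 := norm_le_zero_iff.1
      (norm_unitExt_le _ le_rfl fun u => by simp)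
    refine hL.induction_on (p := fun L => ∃ ψ : C_c(UnitSpace G, ℂ),
      toReduced (unitExt ψ) ∈ I.1 ∧ (∀ u, ψ u = (‖ψ u‖ : ℂ)) ∧ ∀ u ∈ L, ψ u ≠ 0)
      ?_ ?_ ?_ ?_
    · exact ⟨0, by rw [hzero]; exact I.1.zero_mem, fun u => by simp, fun u hu => hu.elim⟩
    · rintro s t hst ⟨ψ, h1, h2, h3⟩
      exact ⟨ψ, h1, h2, fun u hu => h3 u (hst hu)⟩
    · rintro s t ⟨ψ, h1, h2, h3⟩ ⟨ψ', h1', h2', h3'⟩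
      have hsum : ∀ u, (ψ + ψ') u = ((‖ψ u‖ + ‖ψ' u‖ : ℝ) : ℂ) := fun u => by
        rw [CompactlySupportedContinuousMap.add_apply]
        push_cast
        rw [← h2, ← h2']
      have hnorm : ∀ u, ‖(ψ + ψ') u‖ = ‖ψ u‖ + ‖ψ' u‖ := fun u => by
        rw [hsum, Complex.norm_real, Real.norm_of_nonneg (by positivity)]
      refine ⟨ψ + ψ', ?_, fun u => by rw [hnorm, ← hsum], fun u hu => ?_⟩
      · have h4 : unitExt (ψ + ψ') = unitExt ψ + unitExt ψ' := by
          ext x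
          rw [CompactlySupportedContinuousMap.add_apply]
          by_cases hx : x ∈ Set.range (UnitSpace.arrow (G := G))
          · obtain ⟨v, rfl⟩ := hx
            simp only [unitExt_arrow, CompactlySupportedContinuousMap.add_apply]
          · simp only [extendCc_apply_of_notMem _ _ hx, add_zero]
        rw [h4, toReduced_add]
        exact I.1.add_mem h1 h1'
      · rw [← norm_pos_iff, hnorm]
        rcases hu with hu | hu
        · exact add_pos_of_pos_of_nonneg (norm_pos_iff.2 (h3 u hu)) (norm_nonneg _)
        · exact add_pos_of_nonneg_of_pos (norm_nonneg _) (norm_pos_iff.2 (h3' u hu))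
    · intro u hu
      obtain ⟨φ, hφ, hne⟩ := (mem_idealSupport_iff I u).1 (hLI hu)
      refine ⟨{v | φ v ≠ 0}, mem_nhdsWithin_of_mem_nhds
        ((isOpen_ne_fun φ.continuous continuous_const).mem_nhds hne),
        mulCc ⟨fun v => star (φ v), continuous_star.comp φ.continuous⟩ φ, I.mulCc_mem _ hφ,
        fun v => ?_, fun v hv => ?_⟩
      · rw [mulCc_apply, norm_mul]
        change (starRingEnd ℂ) (φ v) * φ v = ((‖star (φ v)‖ * _ : ℝ) : ℂ)
        rw [Complex.conj_mul', norm_star]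
        push_cast
        ring
      · exact mul_ne_zero (star_ne_zero.2 hv) hv
  obtain ⟨ψ, h1, h2, h3⟩ := hpos
  obtain ⟨δ, hδ, hδL⟩ : ∃ δ : ℝ, 0 < δ ∧ ∀ u ∈ L, δ ≤ ‖ψ u‖ := by
    rcases L.eq_empty_or_nonempty with rfl | hne
    · exact ⟨1, one_pos, fun u hu => hu.elim⟩
    · obtain ⟨v, hv, hmin⟩ := hL.exists_isMinOn hne ψ.continuous.norm.continuousOn
      exact ⟨‖ψ v‖, norm_pos_iff.2 (h3 v hv), fun u hu => hmin hu⟩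
  have hmax : ∀ u, 0 < max ‖ψ u‖ δ := fun u => lt_max_of_lt_right hδ
  let q : C(UnitSpace G, ℂ) := ⟨fun u => (((max ‖ψ u‖ δ)⁻¹ : ℝ) : ℂ), by
    have hc := ψ.continuous
    exact Complex.continuous_ofReal.comp (Continuous.inv₀ (by fun_prop) fun u => (hmax u).ne')⟩
  refine ⟨mulCc q ψ, I.mulCc_mem q h1, fun u hu => ?_, fun u => ?_⟩
  · change (((max ‖ψ u‖ δ)⁻¹ : ℝ) : ℂ) * ψ u = 1
    rw [max_eq_left (hδL u hu), h2 u, Complex.norm_real, norm_norm, ← Complex.ofReal_mul,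
      inv_mul_cancel₀ (norm_pos_iff.2 (h3 u hu)).ne', Complex.ofReal_one]
  · change ‖(((max ‖ψ u‖ δ)⁻¹ : ℝ) : ℂ) * ψ u‖ ≤ 1
    rw [norm_mul, Complex.norm_real, Real.norm_of_nonneg (inv_nonneg.2 (hmax u).le),
      inv_mul_le_one₀ (hmax u)]
    exact le_max_left _ _

/-- The set where `‖f‖ ≥ δ` is compact and its ranges lie in the support of the ideal. Choosing `φ`
in the ideal equal to one on those ranges, `φ * f` differs from `f` by at most `2 * δ`, within the
fixed compact support of `f`, where the supremum norm controls the reduced norm. -/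
theorem ClosedIdeal.toReduced_mem (I : ClosedIdeal G) (f : C_c(G, ℂ))
    (hf : ∀ x, rng x ∉ idealSupport I → f x = 0) : toReduced f ∈ I.1 := by
  obtain ⟨N, hN, hNf⟩ := exists_norm_regularRep_le f.hasCompactSupport.isCompact
  refine I.mem_of_approx fun ε hε => ?_
  set δ := ε / (2 * N + 1)
  have hδ : 0 < δ := by positivity
  have hL : IsCompact (rng '' (tsupport f ∩ {x | δ ≤ ‖f x‖})) :=
    (f.hasCompactSupport.isCompact.inter_right
      (isClosed_le continuous_const f.continuous.norm)).image continuous_rng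
  obtain ⟨φ, hφI, hφ1, hφ⟩ := I.exists_one_on_compact hL (by
    rintro _ ⟨x, ⟨-, hx⟩, rfl⟩
    by_contra h0
    have hx' : δ ≤ ‖f x‖ := hx
    rw [hf x h0, norm_zero] at hx'
    linarith)
  refine ⟨toReduced (convCc (unitExt φ) f), ?_, ?_⟩
  · rw [toReduced_convCc]
    exact I.1.mul_mem_right _ _ hφI
  · rw [← toReduced_sub]
    have hval : ∀ x, (f - convCc (unitExt φ) f) x = (1 - φ (rng x)) * f x := fun x => by
      rw [CompactlySupportedContinuousMap.sub_apply, coe_convCc, conv_unitExt, sub_mul, one_mul]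
    refine (hNf _ (2 * δ) (by positivity) (fun x hx => ?_) fun x => ?_).trans_lt ?_
    · rw [hval] at hx
      exact subset_tsupport _ (right_ne_zero_of_mul hx)
    · rw [hval, norm_mul]
      by_cases hx : δ ≤ ‖f x‖
      · have hfx : f x ≠ 0 := norm_pos_iff.1 (hδ.trans_le hx)
        rw [hφ1 _ ⟨x, ⟨subset_tsupport _ hfx, hx⟩, rfl⟩, sub_self, norm_zero, zero_mul]
        positivity
      · refine mul_le_mul ?_ (not_le.1 hx).le (norm_nonneg _) zero_le_two
        refine (norm_sub_le _ _).trans ?_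
        rw [norm_one]
        linarith [hφ (rng x)]
    · rw [show N * (2 * δ) = ε * (2 * N / (2 * N + 1)) by simp only [δ]; ring]
      refine mul_lt_of_lt_one_right hε ?_
      rw [div_lt_one (by positivity)]
      linarith

/-- Over every closed invariant set `D` the elements of `C_r^*(G)` that vanish on `G_D` are limits
of functions in `C_c(G)` that vanish on `G_D`. -/
def VanishingApproximation (G : Type*) [TopologicalSpace G] [ArrowGroupoid G] [IsEtale G] : Prop :=
  ∀ D : Set (UnitSpace G), IsClosed D → IsInvariant D → ∀ a : reducedCStar G,
    (∀ x, rng x ∈ D → coef a x = 0) → ∀ ε > 0,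
      ∃ f : C_c(G, ℂ), (∀ x, rng x ∈ D → f x = 0) ∧ ‖a - toReduced f‖ < ε

theorem mem_ideal_iff (hG : EssentiallyPrincipal G) (hV : VanishingApproximation G)
    (I : ClosedIdeal G) (a : reducedCStar G) :
    a ∈ I.1 ↔ ∀ x, rng x ∉ idealSupport I → coef a x = 0 := by
  refine ⟨fun ha x hx => coef_eq_zero_of_mem hG I ha hx, fun h => ?_⟩
  refine I.mem_of_approx fun ε hε => ?_
  obtain ⟨f, hf, hlt⟩ := hV _ (isOpen_idealSupport I).isClosed_compl
    (isInvariant_idealSupport I).compl a h ε hε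
  exact ⟨toReduced f, I.toReduced_mem f hf, hlt⟩

theorem separatesIdeals_of_vanishingApproximation (hG : EssentiallyPrincipal G)
    (hV : VanishingApproximation G) : SeparatesIdeals G := by
  intro I J hIJ
  refine Subtype.ext (SetLike.ext fun a => ?_)
  rw [mem_ideal_iff hG hV, mem_ideal_iff hG hV, hIJ]

end ClosedIdeals

/-! ### Inner exactness gives the approximation property. -/

section InnerExactness

/-- The reduced groupoid algebra as a `C*`-algebra. -/
noncomputable abbrev reducedCStarAlgebra (G : Type*) [TopologicalSpace G] [ArrowGroupoid G]
    [IsEtale G] : NonUnitalCStarAlgebra (reducedCStar G) :=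
  NonUnitalStarSubalgebra.nonUnitalCStarAlgebra (reducedCStar G)
    (h_closed := NonUnitalStarSubalgebra.isClosed_topologicalClosure _)

theorem norm_starHom_le {G H : Type*} [TopologicalSpace G] [ArrowGroupoid G] [IsEtale G]
    [TopologicalSpace H] [ArrowGroupoid H] [IsEtale H] (φ : reducedCStar G →⋆ₙₐ[ℂ] reducedCStar H)
    (a : reducedCStar G) : ‖φ a‖ ≤ ‖a‖ :=
  letI := reducedCStarAlgebra G
  letI := reducedCStarAlgebra H
  NonUnitalStarAlgHom.norm_apply_le φ a

/-- The coefficients of `π a` are those of `a` restricted to `G_D`. If they vanish, exactness writes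
`a = ι b`, and `C_c` approximations of `b` extended by zero approximate `a`, because `ι` is
contractive. -/
theorem vanishingApproximation_of_innerExact {G : Type*} [TopologicalSpace G] [ArrowGroupoid G]
    [IsEtale G] (h : InnerExact G) : VanishingApproximation G := by
  intro D hD hinv a ha ε hε
  have : IsEtale (Restr D) := isEtale_restr hinv (Or.inl hD)
  have : IsEtale (Restr Dᶜ) := isEtale_restr hinv.compl (Or.inr hD.isOpen_compl)
  obtain ⟨ι, π, hι, hπ, -, hex, -⟩ := h D hD hinv
  have hcont : Continuous π :=
    AddMonoidHomClass.continuous_of_bound π 1 fun a => by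
      rw [one_mul]; exact norm_starHom_le π a
  have hcoef : ∀ (a : reducedCStar G) (x : Restr D), coef (π a) x = coef a x.incl := fun a x => by
    refine denseRange_toReduced.induction_on a
      (isClosed_eq ((continuous_coef_left x).comp hcont) (continuous_coef_left _)) fun f => ?_
    rw [hπ, coef_toReduced, coef_toReduced, restrictCc_apply]
  have hπa : π a = 0 := eq_zero_of_coef _ fun x => by
    rw [hcoef]
    exact ha _ x.2.2
  obtain ⟨b, rfl⟩ := (hex a).1 hπa
  obtain ⟨f, hf⟩ := exists_toReduced_near b hε
  refine ⟨extendCc (isOpenEmbedding_incl hD.isOpen_compl) f, fun x hx => ?_, ?_⟩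
  · refine extendCc_apply_of_notMem _ _ ?_
    rintro ⟨y, rfl⟩
    exact y.2.2 hx
  · rw [← hι, ← map_sub]
    exact (norm_starHom_le ι _).trans_lt hf

end InnerExactness

/-! ### Cauchy–Schwarz and square-root estimates. -/

section Inequalities

theorem enorm_tsum_mul_sq_le {ι : Type*} (a b : ι → ℂ) :
    ‖∑' i, a i * b i‖ₑ ^ (2 : ℝ) ≤ (∑' i, ‖a i‖ₑ ^ (2 : ℝ)) * ∑' i, ‖b i‖ₑ ^ (2 : ℝ) := by
  have h : ∑' i, ‖a i‖ₑ * ‖b i‖ₑ ≤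
      (∑' i, ‖a i‖ₑ ^ (2 : ℝ)) ^ (1 / 2 : ℝ) * (∑' i, ‖b i‖ₑ ^ (2 : ℝ)) ^ (1 / 2 : ℝ) := by
    rw [ENNReal.tsum_eq_iSup_sum]
    refine iSup_le fun s => ?_
    refine (ENNReal.inner_le_Lp_mul_Lq s _ _ (Real.HolderConjugate.two_two)).trans ?_
    exact mul_le_mul' (ENNReal.rpow_le_rpow (ENNReal.sum_le_tsum s) (by norm_num))
      (ENNReal.rpow_le_rpow (ENNReal.sum_le_tsum s) (by norm_num))
  have h2 : ‖∑' i, a i * b i‖ₑ ≤ ∑' i, ‖a i‖ₑ * ‖b i‖ₑ := by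
    simpa only [enorm_mul] using enorm_tsum_le_tsum_enorm (f := fun i => a i * b i)
  refine (ENNReal.rpow_le_rpow (h2.trans h) (by norm_num : (0 : ℝ) ≤ 2)).trans ?_
  rw [ENNReal.mul_rpow_of_nonneg _ _ (by norm_num), ← ENNReal.rpow_mul, ← ENNReal.rpow_mul]
  norm_num

theorem sq_sub_le_abs_sq_sub_sq {a b : ℝ} (ha : 0 ≤ a) (hb : 0 ≤ b) :
    (b - a) ^ 2 ≤ |b ^ 2 - a ^ 2| := by
  rw [sq_sub_sq, abs_mul, abs_of_nonneg (add_nonneg hb ha), ← sq_abs, sq]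
  refine mul_le_mul_of_nonneg_right ?_ (abs_nonneg _)
  rw [abs_le]
  constructor <;> linarith

/-- Used with `a`, `b` square roots of an almost invariant density and of its translate: `(b - a)² ≤
|b² - a²|` turns `ℓ¹`-invariance into `ℓ²`-invariance. Then `∑ a * b - 1` splits into an error `η²`
and a term bounded by `2 * η` through Cauchy–Schwarz. -/
theorem abs_sum_mul_sub_one_le {ι : Type*} (s : Finset ι) {a b : ι → ℝ} (ha : ∀ i, 0 ≤ a i)
    (hb : ∀ i, 0 ≤ b i) {η : ℝ} (hη : 0 ≤ η) (hη1 : η ≤ 1)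
    (h1 : |∑ i ∈ s, a i ^ 2 - 1| ≤ η ^ 2)
    (h2 : ∑ i ∈ s, |b i ^ 2 - a i ^ 2| ≤ η ^ 2) : |∑ i ∈ s, a i * b i - 1| ≤ 3 * η := by
  have h3 : ∑ i ∈ s, a i * b i - 1 = (∑ i ∈ s, a i ^ 2 - 1) + ∑ i ∈ s, a i * (b i - a i) := by
    rw [sub_add_eq_add_sub, ← Finset.sum_add_distrib]
    congr 1
    exact Finset.sum_congr rfl fun i _ => by ring
  have h4 : (∑ i ∈ s, a i * (b i - a i)) ^ 2 ≤ (2 * η) ^ 2 := by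
    refine (Finset.sum_mul_sq_le_sq_mul_sq s _ _).trans ?_
    have h5 : ∑ i ∈ s, (b i - a i) ^ 2 ≤ η ^ 2 :=
      (Finset.sum_le_sum fun i _ => sq_sub_le_abs_sq_sub_sq (ha i) (hb i)).trans h2
    have h6 : ∑ i ∈ s, a i ^ 2 ≤ 2 := by nlinarith [(abs_le.1 h1).2]
    have h7 : 0 ≤ ∑ i ∈ s, (b i - a i) ^ 2 := Finset.sum_nonneg fun i _ => sq_nonneg _
    nlinarith
  have h8 := abs_le_of_sq_le_sq h4 (by positivity)
  rw [h3]
  refine (abs_add_le _ _).trans ((add_le_add h1 h8).trans ?_)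
  nlinarith

end Inequalities

/-! ### Multipliers from amenability, and the approximation property. -/

section Amenability

variable {G : Type*} [ArrowGroupoid G]

theorem tsum_fibre_mul (F : G → ℝ≥0∞) (x : G) :
    ∑' l : {l : G // rng l = dom x}, F (x * l) = ∑' p : {p : G // rng p = rng x}, F p := by
  rw [← (leftMulEquiv x).tsum_eq]; rfl

variable [TopologicalSpace G]

open Classical in
/-- Multiplication by `y ↦ conj (ξ (y l))`, on the arrows `y` composable with `l`. -/
noncomputable def translateOp (ξ : C_c(G, ℂ)) (l : G) : ell2 G →L[ℂ] ell2 G :=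
  mulOp (fun y => if dom y = rng l then star (ξ (y * l)) else 0) (by
    obtain ⟨C, hC⟩ := ξ.hasCompactSupport.exists_bound_of_continuous ξ.continuous
    refine ⟨C, fun y => ?_⟩
    have h0 : 0 ≤ C := (norm_nonneg _).trans (hC l)
    split_ifs
    · rw [norm_star]; exact hC _
    · rwa [norm_zero])

theorem translateOp_apply (ξ : C_c(G, ℂ)) {l y : G} (h : dom y = rng l) (η : ell2 G) :
    translateOp ξ l η y = star (ξ (y * l)) * η y := by
  rw [translateOp, mulOp_apply, if_pos h]

/-- For fixed `y` the substitution `p = y * l` turns the sum over `l` into the sum of `‖ξ p‖²` over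
the range fibre of `y`. -/
theorem tsum_translateOp_le (ξ : C_c(G, ℂ))
    (hξ : ∀ u, ∑' k : {k : G // rng k = u}, ‖ξ k‖ₑ ^ (2 : ℝ) ≤ 2) (η : ell2 G) :
    ∑' l, ∑' y, ‖translateOp ξ l η y‖ₑ ^ (2 : ℝ) ≤ 2 * ∑' y, ‖η y‖ₑ ^ (2 : ℝ) := by
  rw [ENNReal.tsum_comm, ← ENNReal.tsum_mul_left]
  refine ENNReal.tsum_le_tsum fun y => ?_
  have h1 : ∀ l, ‖translateOp ξ l η y‖ₑ ^ (2 : ℝ) =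
      {l | rng l = dom y}.indicator (fun l => ‖ξ (y * l)‖ₑ ^ (2 : ℝ)) l * ‖η y‖ₑ ^ (2 : ℝ) := by
    intro l
    by_cases h : rng l = dom y
    · rw [translateOp_apply ξ h.symm, enorm_mul, ENNReal.mul_rpow_of_nonneg _ _ (by norm_num),
        Set.indicator_of_mem (show l ∈ {l | rng l = dom y} from h)]
      congr 2
      rw [← ofReal_norm, norm_star, ofReal_norm]
    · rw [Set.indicator_of_notMem (show l ∉ {l | rng l = dom y} from h), zero_mul, translateOp,
        mulOp_apply, if_neg (Ne.symm h), zero_mul, enorm_zero,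
        ENNReal.zero_rpow_of_pos (by norm_num)]
  simp only [h1]
  rw [ENNReal.tsum_mul_right]
  gcongr
  rw [← tsum_subtype]
  exact (tsum_fibre_mul (fun p => ‖ξ p‖ₑ ^ (2 : ℝ)) y).trans_le (hξ _)

variable [IsEtale G]

/-- Take `ξ = (φ ∘ rng) * √f` with `f` from amenability. Amenability controls `f` only over a
compact set; the cutoff `φ` makes the fibre bound hold at every unit while leaving `√f` unchanged
over the ranges and domains of `K`. -/
theorem exists_almost_invariant (hG : Amenable G) {K : Set G} (hK : IsCompact K) {ε : ℝ}
    (hε : 0 < ε) : ∃ ξ : C_c(G, ℂ),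
      (∀ u, ∑' k : {k : G // rng k = u}, ‖ξ k‖ₑ ^ (2 : ℝ) ≤ 2) ∧
      ∀ g ∈ K, ‖conv ξ (invol ξ) g - 1‖ ≤ ε := by
  classical
  obtain ⟨φ, hφ1, -, hφ⟩ := exists_bump
    ((hK.image continuous_rng).union (hK.image continuous_dom)) isOpen_univ (Set.subset_univ _)
  set η := min 1 (ε / 3)
  have hη : 0 < η := lt_min one_pos (by positivity)
  have hη1 : η ≤ 1 := min_le_left _ _
  have hηε : 3 * η ≤ ε := by linarith [min_le_right 1 (ε / 3)]
  obtain ⟨f, hf0, hf⟩ := hG (K ∪ UnitSpace.arrow '' tsupport φ)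
    (hK.union (φ.hasCompactSupport.isCompact.image continuous_arrow)) (η ^ 2) (by positivity)
  let fc : C_c(G, ℂ) := ⟨⟨fun x => (f x : ℂ), by have := f.continuous; fun_prop⟩,
    f.hasCompactSupport.comp_left (g := fun t : ℝ => (t : ℂ)) Complex.ofReal_zero⟩
  have hfin : ∀ u : UnitSpace G, {h : {h : G // rng h = u} | f h ≠ 0}.Finite := fun u =>
    (finite_fibre fc u).subset fun h hh => by
      change (f h : ℂ) ≠ 0
      exact_mod_cast hh
  let sc : C_c(G, ℂ) := ⟨⟨fun x => (Real.sqrt (f x) : ℂ), by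
      have := f.continuous; fun_prop⟩,
    f.hasCompactSupport.comp_left (g := fun t : ℝ => (Real.sqrt t : ℂ)) (by simp)⟩
  let ξ : C_c(G, ℂ) := mulCc ⟨fun x => φ (rng x), φ.continuous.comp continuous_rng⟩ sc
  have hξ : ∀ x, ξ x = φ (rng x) * (Real.sqrt (f x) : ℂ) := fun _ => rfl
  refine ⟨ξ, fun u => ?_, fun g hg => ?_⟩
  · by_cases hu : φ u = 0
    · refine le_of_eq_of_le (ENNReal.tsum_eq_zero.2 fun k => ?_) zero_le
      rw [hξ, k.2, hu, zero_mul, enorm_zero, ENNReal.zero_rpow_of_pos (by norm_num)]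
    · have h1 := (hf u.arrow (Or.inr ⟨u, subset_tsupport _ hu, rfl⟩)).1
      rw [rng_unit] at h1
      have h2 : ∀ k : {k : G // rng k = u}, ‖ξ k‖ₑ ^ (2 : ℝ) ≤ ENNReal.ofReal (f k) := fun k => by
        rw [← enorm_sq_eq]
        refine ENNReal.ofReal_le_ofReal ?_
        rw [hξ, norm_mul, Complex.norm_real, Real.norm_of_nonneg (Real.sqrt_nonneg _),
          Real.rpow_two, mul_pow, Real.sq_sqrt (hf0 _)]
        exact mul_le_of_le_one_left (hf0 _) (pow_le_one₀ (norm_nonneg _) (hφ _))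
      refine (ENNReal.tsum_le_tsum h2).trans ?_
      rw [← ENNReal.ofReal_tsum_of_nonneg (fun k => hf0 _)
        (summable_of_hasFiniteSupport (hfin u))]
      refine ENNReal.ofReal_le_of_le_toReal ?_
      rw [ENNReal.toReal_ofNat]
      nlinarith [(abs_lt.1 h1).2]
  · obtain ⟨h1, h2⟩ := hf g (Or.inl hg)
    have hinj : Function.Injective (fun h : {h : G // rng h = rng g} =>
        (⟨g⁻¹ * h, rng_inv_mul h.2.symm⟩ : {l : G // rng l = dom g})) := by
      intro a b hab
      refine Subtype.ext ?_
      have h4 : g⁻¹ * (a : G) = g⁻¹ * b := congrArg Subtype.val hab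
      rw [← mul_inv_cancel_left' a.2.symm, h4, mul_inv_cancel_left' b.2.symm]
    have hfin2 : {h : {h : G // rng h = rng g} | f (g⁻¹ * h) ≠ 0}.Finite :=
      (hfin (dom g)).preimage hinj.injOn
    let T := (hfin (rng g)).toFinset ∪ hfin2.toFinset
    have hT1 : ∀ h : {h : G // rng h = rng g}, h ∉ T → f h = 0 := fun h hh => by
      by_contra h0
      exact hh (Finset.mem_union_left _ ((hfin (rng g)).mem_toFinset.2 h0))
    have hT2 : ∀ h : {h : G // rng h = rng g}, h ∉ T → f (g⁻¹ * h) = 0 := fun h hh => by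
      by_contra h0
      exact hh (Finset.mem_union_right _ (hfin2.mem_toFinset.2 h0))
    rw [tsum_eq_sum (s := T) hT1] at h1
    rw [tsum_eq_sum (s := T) fun h hh => by rw [hT1 h hh, hT2 h hh, sub_zero, abs_zero]] at h2
    have hr : φ (rng g) = 1 := hφ1 _ (Or.inl ⟨g, hg, rfl⟩)
    have hd : φ (dom g) = 1 := hφ1 _ (Or.inr ⟨g, hg, rfl⟩)
    have key : conv ξ (invol ξ) g =
        ((∑ h ∈ T, Real.sqrt (f h) * Real.sqrt (f (g⁻¹ * h)) : ℝ) : ℂ) := by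
      rw [conv_invol, tsum_eq_sum (s := T)]
      · push_cast
        refine Finset.sum_congr rfl fun h _ => ?_
        rw [hξ, hξ, h.2, rng_inv_mul h.2.symm, hr, hd, one_mul, one_mul]
        exact congrArg _ (Complex.conj_ofReal _)
      · intro h hh
        rw [hξ, hT1 h hh, Real.sqrt_zero, Complex.ofReal_zero, mul_zero, zero_mul]
    rw [key, ← Complex.ofReal_one, ← Complex.ofReal_sub, Complex.norm_real, Real.norm_eq_abs]
    refine (abs_sum_mul_sub_one_le T (fun _ => Real.sqrt_nonneg _) (fun _ => Real.sqrt_nonneg _)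
      hη.le hη1 ?_ ?_).trans hηε
    · simp only [Real.sq_sqrt (hf0 _)]
      exact h1.le
    · simp only [Real.sq_sqrt (hf0 _)]
      exact h2.le

/-- The integrated form of the positive definite multiplier `ξ * ξ^*`. -/
theorem regularRep_multiplier_apply (ξ f : C_c(G, ℂ)) (η : ell2 G) (x : G) :
    regularRep (convCc ξ (involCc ξ) * f) η x =
      ∑' l : {l : G // rng l = dom x}, ξ (x * l) * regularRep f (translateOp ξ l η) x := by
  have h1 : regularRep (convCc ξ (involCc ξ) * f) η x =
      ∑' (k : {k : G // rng k = rng x}) (l : {l : G // rng l = dom x}),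
        ξ (x * l) * (f k * (star (ξ ((k : G)⁻¹ * (x * l))) * η ((k : G)⁻¹ * x))) := by
    refine tsum_congr fun k => ?_
    -- Parametrising the range fibre of `x` by `p = x * l` separates the factor `ξ (x * l)` from one
    -- depending only on `l` and `y = k⁻¹ * x`, which `translateOp ξ l` absorbs.
    have h2 : convCc ξ (involCc ξ) k =
        ∑' l : {l : G // rng l = dom x}, ξ (x * l) * star (ξ ((k : G)⁻¹ * (x * l))) := by
      rw [coe_convCc, coe_involCc, conv_invol]
      have h3 : (∑' p : {p : G // rng p = rng (k : G)}, ξ p * star (ξ ((k : G)⁻¹ * p))) =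
          ∑' p : {p : G // rng p = rng x}, ξ p * star (ξ ((k : G)⁻¹ * p)) := by
        rw [k.2]
      rw [h3, ← (leftMulEquiv x).tsum_eq]
      rfl
    rw [CompactlySupportedContinuousMap.mul_apply, h2, ← tsum_mul_right, ← tsum_mul_right]
    exact tsum_congr fun l => by ring
  rw [h1]
  refine (Summable.tsum_comm ?_).trans (tsum_congr fun l => ?_)
  · have hfin : {l : {l : G // rng l = dom x} | ξ (x * l) ≠ 0}.Finite :=
      (finite_fibre ξ (rng x)).preimage (leftMulEquiv x).injective.injOn
    refine summable_of_hasFiniteSupport ((hfin.prod (finite_fibre f (rng x))).subset ?_)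
    rintro ⟨l, k⟩ hkl
    have h5 : ξ (x * l) * (f k * (star (ξ ((k : G)⁻¹ * (x * l))) * η ((k : G)⁻¹ * x))) ≠ 0 := hkl
    exact ⟨left_ne_zero_of_mul h5, left_ne_zero_of_mul (right_ne_zero_of_mul h5)⟩
  · rw [regularRep_apply, ← tsum_mul_left]
    refine tsum_congr fun k => ?_
    rw [translateOp_apply ξ (by rw [dom_inv_mul k.2, l.2]),
      mul_assoc' (by rw [dom_inv, k.2]) l.2.symm]

theorem tsum_enorm_apply_le {X Y : Type*} (T : ell2 X →L[ℂ] ell2 Y) (ξ : ell2 X) :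
    ∑' y, ‖T ξ y‖ₑ ^ (2 : ℝ) ≤ ENNReal.ofReal ‖T‖ ^ (2 : ℝ) * ∑' x, ‖ξ x‖ₑ ^ (2 : ℝ) := by
  rw [← ell2_enorm, ← ell2_enorm, ENNReal.ofReal_rpow_of_nonneg (norm_nonneg _) (by norm_num),
    ← ENNReal.ofReal_mul (by positivity), ← Real.mul_rpow (norm_nonneg _) (norm_nonneg _)]
  exact ENNReal.ofReal_le_ofReal
    (Real.rpow_le_rpow (norm_nonneg _) (T.le_opNorm ξ) (by norm_num))

/-- In the formula `regularRep_multiplier_apply`, Cauchy–Schwarz in `l` costs one factor `2`, and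
summing `‖translateOp ξ l η‖²` over `l` costs another; the squared norm grows by at most `4`. -/
theorem norm_multiplier_le (ξ f : C_c(G, ℂ))
    (hξ : ∀ u, ∑' k : {k : G // rng k = u}, ‖ξ k‖ₑ ^ (2 : ℝ) ≤ 2) :
    ‖regularRep (convCc ξ (involCc ξ) * f)‖ ≤ 2 * ‖regularRep f‖ := by
  refine norm_le_of_enorm (by positivity) fun η => ?_
  calc ∑' x, ‖regularRep (convCc ξ (involCc ξ) * f) η x‖ₑ ^ (2 : ℝ)
      ≤ ∑' x, 2 * ∑' l, ‖regularRep f (translateOp ξ l η) x‖ₑ ^ (2 : ℝ) := by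
        refine ENNReal.tsum_le_tsum fun x => ?_
        rw [regularRep_multiplier_apply]
        refine (enorm_tsum_mul_sq_le _ _).trans (mul_le_mul' ?_ ?_)
        · exact (tsum_fibre_mul (fun p => ‖ξ p‖ₑ ^ (2 : ℝ)) x).trans_le (hξ _)
        · exact ENNReal.tsum_comp_le_tsum_of_injective Subtype.val_injective _
    _ = 2 * ∑' l, ∑' x, ‖regularRep f (translateOp ξ l η) x‖ₑ ^ (2 : ℝ) := by
        rw [ENNReal.tsum_mul_left, ENNReal.tsum_comm]
    _ ≤ 2 * ∑' l, ENNReal.ofReal ‖regularRep f‖ ^ (2 : ℝ) *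
          ∑' y, ‖translateOp ξ l η y‖ₑ ^ (2 : ℝ) := by
        gcongr with l
        exact tsum_enorm_apply_le _ _
    _ ≤ 2 * (ENNReal.ofReal ‖regularRep f‖ ^ (2 : ℝ) * (2 * ∑' y, ‖η y‖ₑ ^ (2 : ℝ))) := by
        rw [ENNReal.tsum_mul_left]
        gcongr
        exact tsum_translateOp_le ξ hξ η
    _ = _ := by
        rw [ENNReal.ofReal_mul zero_le_two, ENNReal.mul_rpow_of_nonneg _ _ (by norm_num),
          ENNReal.rpow_two, ENNReal.rpow_two, ENNReal.ofReal_ofNat]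
        ring

/-- The approximant is the pointwise product `coef a * h` with `h = ξ * ξ^*`. It is compared with
`a` through `h * f₁`, `h * f₀` and `f₀`; the four errors are bounded by `1`, `4`, `1` and `1` times
`ε / 7`, the last one strictly. -/
theorem vanishingApproximation_of_amenable (hG : Amenable G) : VanishingApproximation G := by
  intro D hD hinv a ha ε hε
  obtain ⟨f₀, hf₀⟩ := exists_toReduced_near a (ε := ε / 7) (by positivity)
  obtain ⟨N, hN, hNf⟩ := exists_norm_regularRep_le f₀.hasCompactSupport.isCompact
  obtain ⟨C, hC⟩ := f₀.hasCompactSupport.exists_bound_of_continuous f₀.continuous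
  set δ := ε / 7 / (N * max C 0 + 1)
  have hδ : 0 < δ := by positivity
  obtain ⟨ξ, hξ, hξ1⟩ := exists_almost_invariant hG f₀.hasCompactSupport.isCompact hδ
  set h := convCc ξ (involCc ξ)
  obtain ⟨N', hN', hNf'⟩ := exists_norm_regularRep_le h.hasCompactSupport.isCompact
  obtain ⟨C', hC'⟩ := h.hasCompactSupport.exists_bound_of_continuous h.continuous
  -- The multiplier `h` depends on `f₀`, so a second approximation, fine relative to the support and
  -- size of `h`, is needed to compare `h * coef a` with a multiple of a `C_c` function.
  obtain ⟨f₁, hf₁⟩ := exists_toReduced_near a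
    (ε := min (ε / 7) (ε / 7 / (N' * max C' 0 + 1))) (by positivity)
  have hf₁a := hf₁.trans_le (min_le_left _ _)
  have hf₁b := hf₁.trans_le (min_le_right _ _)
  let f := mulCc ⟨coef a, continuous_coef a⟩ h
  refine ⟨f, fun x hx => by rw [mulCc_apply]; exact mul_eq_zero_of_left (ha x hx) _, ?_⟩
  have hsmall : ∀ n c : ℝ, 0 ≤ n → n * (max c 0 * (ε / 7 / (n * max c 0 + 1))) ≤ ε / 7 := by
    intro n c hn
    have h1 : 0 ≤ n * max c 0 := by positivity
    rw [← mul_assoc, mul_div_assoc', div_le_iff₀ (by positivity)]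
    nlinarith
  have e1 : ‖toReduced f - toReduced (h * f₁)‖ ≤ ε / 7 := by
    rw [← toReduced_sub]
    have hval : ∀ x, (f - h * f₁) x = h x * coef (a - toReduced f₁) x := fun x => by
      rw [coef_sub, coef_toReduced, CompactlySupportedContinuousMap.sub_apply,
        CompactlySupportedContinuousMap.mul_apply, mul_sub, mulCc_apply]
      exact congrArg (· - _) (mul_comm _ _)
    refine (hNf' _ (max C' 0 * (ε / 7 / (N' * max C' 0 + 1))) (by positivity)
      (fun x hx => ?_) fun x => ?_).trans (hsmall N' C' hN')
    · rw [hval] at hx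
      exact subset_tsupport _ (left_ne_zero_of_mul hx)
    · rw [hval, norm_mul]
      exact mul_le_mul ((hC' x).trans (le_max_left _ _)) ((norm_coef_le _ x).trans hf₁b.le)
        (norm_nonneg _) (le_max_right _ _)
  have e2 : ‖toReduced (h * f₁) - toReduced (h * f₀)‖ ≤ 4 * (ε / 7) := by
    rw [← toReduced_sub, ← mul_sub]
    refine (norm_multiplier_le ξ (f₁ - f₀) hξ).trans ?_
    have h1 : ‖toReduced (f₁ - f₀)‖ ≤ ε / 7 + ε / 7 := by
      rw [toReduced_sub, ← sub_sub_sub_cancel_left _ _ a]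
      exact (norm_sub_le _ _).trans (add_le_add hf₀.le hf₁a.le)
    change 2 * ‖toReduced (f₁ - f₀)‖ ≤ _
    linarith
  have e3 : ‖toReduced (h * f₀) - toReduced f₀‖ ≤ ε / 7 := by
    rw [← toReduced_sub]
    have hval : ∀ x, (h * f₀ - f₀) x = f₀ x * (h x - 1) := fun x => by
      rw [CompactlySupportedContinuousMap.sub_apply, CompactlySupportedContinuousMap.mul_apply]
      ring
    refine (hNf _ (max C 0 * δ) (by positivity) (fun x hx => ?_) fun x => ?_).trans (hsmall N C hN)
    · rw [hval] at hx
      exact subset_tsupport _ (left_ne_zero_of_mul hx)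
    · rw [hval, norm_mul]
      by_cases hx : f₀ x = 0
      · rw [hx, norm_zero, zero_mul]; positivity
      · exact mul_le_mul ((hC x).trans (le_max_left _ _)) (hξ1 x (subset_tsupport _ hx))
          (norm_nonneg _) (le_max_right _ _)
  have e4 : a - toReduced f = (a - toReduced f₀) - (toReduced (h * f₀) - toReduced f₀) -
      (toReduced (h * f₁) - toReduced (h * f₀)) - (toReduced f - toReduced (h * f₁)) := by abel
  rw [e4]
  have n1 := norm_sub_le ((a - toReduced f₀) - (toReduced (h * f₀) - toReduced f₀) -
      (toReduced (h * f₁) - toReduced (h * f₀))) (toReduced f - toReduced (h * f₁))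
  have n2 := norm_sub_le ((a - toReduced f₀) - (toReduced (h * f₀) - toReduced f₀))
      (toReduced (h * f₁) - toReduced (h * f₀))
  have n3 := norm_sub_le (a - toReduced f₀) (toReduced (h * f₀) - toReduced f₀)
  linarith

end Amenability

/-! ### Sums over isotropy groups and the reduced norm. -/

section IsotropySums

variable {G : Type*} [TopologicalSpace G] [ArrowGroupoid G] [IsEtale G]

open Classical in
/-- The indicator function of a unit. -/
noncomputable def unitIndicator (v w : UnitSpace G) : ℂ := if w = v then 1 else 0

theorem norm_ell2_sq_le {X : Type*} (w : ell2 X) (h : ∑' x, ‖w x‖ₑ ^ (2 : ℝ) ≤ 2) :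
    ‖w‖ ^ 2 ≤ 2 := by
  rw [← ell2_enorm, Real.rpow_two] at h
  simpa using ENNReal.toReal_mono (by norm_num) h

/-- The sum is the matrix coefficient `⟨w, regularRep f w⟩` for `w` the restriction of `ξ` to the
range fibre of `v`, and `‖w‖² ≤ 2`. Cutting `ξ` to that fibre is what selects the arrows `g` with
`dom g = v`. -/
theorem norm_isotropy_sum_multiplier_le (ξ f : C_c(G, ℂ))
    (hξ : ∀ u, ∑' k : {k : G // rng k = u}, ‖ξ k‖ₑ ^ (2 : ℝ) ≤ 2) (v : UnitSpace G) :
    ‖∑' g : {g : G // rng g = v}, f g * (unitIndicator v (dom (g : G)) *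
      star (conv ξ (invol ξ) g))‖ ≤ 2 * ‖regularRep f‖ := by
  classical
  let F : G → ℂ := {k | rng k = v}.indicator ξ
  have hF : ∑' k, ‖F k‖ₑ ^ (2 : ℝ) ≤ 2 := by
    have h1 : ∀ k, ‖F k‖ₑ ^ (2 : ℝ) =
        {k | rng k = v}.indicator (fun k => ‖ξ k‖ₑ ^ (2 : ℝ)) k := fun k => by
      by_cases hk : k ∈ {k | rng k = v}
      · simp only [F, Set.indicator_of_mem hk]
      · simp only [F, Set.indicator_of_notMem hk, enorm_zero]
        exact ENNReal.zero_rpow_of_pos (by norm_num)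
    simp only [h1]
    rw [← tsum_subtype]
    exact hξ v
  let w : ell2 G := ⟨F, memℓp_of_tsum_ne_top (ne_top_of_le_ne_top (by norm_num) hF)⟩
  have hw : ‖w‖ ^ 2 ≤ 2 := norm_ell2_sq_le w hF
  have hwk : ∀ k : G, rng k = v → w k = ξ k := fun k hk =>
    Set.indicator_of_mem (show k ∈ {k | rng k = v} from hk) _
  have hwk0 : ∀ k : G, rng k ≠ v → w k = 0 := fun k hk =>
    Set.indicator_of_notMem (show k ∉ {k | rng k = v} from hk) _
  have key : inner ℂ w (regularRep f w) = ∑' g : {g : G // rng g = v},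
      f g * (unitIndicator v (dom (g : G)) * star (conv ξ (invol ξ) g)) := by
    rw [lp.inner_eq_tsum]
    have h1 : (∑' k, inner ℂ (w k) (regularRep f w k)) =
        ∑' k : {k : G // rng k = v}, inner ℂ (w k) (regularRep f w k) := by
      refine (tsum_subtype_eq_of_support_subset (s := {k : G | rng k = v}) fun k hk => ?_).symm
      by_contra h0
      exact hk (by simp only [hwk0 k h0, inner_zero_left])
    have h2 : ∀ k : {k : G // rng k = v}, inner ℂ (w k) (regularRep f w k) =
        ∑' g : {g : G // rng g = v}, star (ξ k) *
          (f g * (unitIndicator v (dom (g : G)) * ξ ((g : G)⁻¹ * k))) := fun k => by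
      rw [hwk k k.2, regularRep_eq_conv, conv_eq_tsum k.2, RCLike.inner_apply, mul_comm,
        ← tsum_mul_left]
      refine tsum_congr fun g => ?_
      congr 2
      have h3 : rng ((g : G)⁻¹ * k) = dom (g : G) := rng_inv_mul (g.2.trans k.2.symm)
      by_cases hd : dom (g : G) = v
      · rw [hwk _ (h3.trans hd), unitIndicator, if_pos hd, one_mul]
      · rw [hwk0 _ (by rwa [h3]), unitIndicator, if_neg hd, zero_mul]
    rw [h1, tsum_congr h2]
    refine (Summable.tsum_comm ?_).trans (tsum_congr fun g => ?_)
    · refine summable_of_hasFiniteSupport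
        (((finite_fibre f v).prod (finite_fibre ξ v)).subset ?_)
      rintro ⟨g, k⟩ hkg
      have h5 : star (ξ k) * (f g * (unitIndicator v (dom (g : G)) * ξ ((g : G)⁻¹ * k))) ≠ 0 := hkg
      exact ⟨left_ne_zero_of_mul (right_ne_zero_of_mul h5),
        star_ne_zero.1 (left_ne_zero_of_mul h5)⟩
    · rw [conv_invol, tsum_star, ← tsum_mul_left, ← tsum_mul_left]
      have h4 : ∀ u, u = v → (∑' k : {k : G // rng k = v},
          star (ξ k) * (f g * (unitIndicator v (dom (g : G)) * ξ ((g : G)⁻¹ * k)))) =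
          ∑' k : {k : G // rng k = u}, f g * (unitIndicator v (dom (g : G)) *
            star (ξ k * star (ξ ((g : G)⁻¹ * k)))) := by
        rintro _ rfl
        exact tsum_congr fun k => by rw [star_mul', star_star]; ring
      exact h4 _ g.2
  rw [← key]
  have h6 := norm_inner_le_norm (𝕜 := ℂ) w (regularRep f w)
  have h7 := (regularRep f).le_opNorm w
  nlinarith [norm_nonneg w, norm_nonneg (regularRep f)]

/-- For amenable `G` the sum of `f` over an isotropy group is dominated by the reduced norm. -/
theorem norm_isotropy_sum_le (hG : Amenable G) (f : C_c(G, ℂ)) (v : UnitSpace G) :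
    ‖conv f (fun y => unitIndicator v (rng y)) v.arrow‖ ≤ 2 * ‖regularRep f‖ := by
  rw [conv_comp_rng]
  have h0 : ∀ u, u = v → (∑' h : {h : G // rng h = u}, f h * unitIndicator v (dom (h : G))) =
      ∑' h : {h : G // rng h = v}, f h * unitIndicator v (dom (h : G)) := by
    rintro _ rfl; rfl
  rw [h0 _ (rng_unit v)]
  set T := (finite_fibre f v).toFinset
  have hT : ∀ g : {g : G // rng g = v}, g ∉ T → f g = 0 := fun g hg => by
    by_contra h
    exact hg ((finite_fibre f v).mem_toFinset.2 h)
  refine le_of_forall_pos_le_add fun ε hε => ?_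
  set B := ∑ g ∈ T, ‖f g * unitIndicator v (dom (g : G))‖
  have hB : 0 ≤ B := Finset.sum_nonneg fun _ _ => norm_nonneg _
  -- Only the finitely many arrows in `T` contribute, so a multiplier close to one on them changes
  -- the sum by at most `ε`.
  obtain ⟨ξ, hξ, hξ1⟩ := exists_almost_invariant hG
    ((T.finite_toSet.image (Subtype.val : {g : G // rng g = v} → G)).isCompact)
    (ε := ε / (B + 1)) (by positivity)
  have h1 := norm_isotropy_sum_multiplier_le ξ f hξ v
  rw [tsum_eq_sum (s := T) fun g hg => by rw [hT g hg, zero_mul]] at h1 ⊢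
  have h2 : ‖∑ g ∈ T, f g * unitIndicator v (dom (g : G)) -
      ∑ g ∈ T, f g * (unitIndicator v (dom (g : G)) * star (conv ξ (invol ξ) g))‖ ≤ ε := by
    rw [← Finset.sum_sub_distrib]
    calc _ ≤ ∑ g ∈ T, ‖f g * unitIndicator v (dom (g : G))‖ * (ε / (B + 1)) := by
          refine norm_sum_le_of_le T fun g hg => ?_
          rw [show f g * unitIndicator v (dom (g : G)) -
            f g * (unitIndicator v (dom (g : G)) * star (conv ξ (invol ξ) g)) =
            f g * unitIndicator v (dom (g : G)) * star (1 - conv ξ (invol ξ) g) by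
              rw [star_sub, star_one]; ring, norm_mul, norm_star, norm_sub_rev]
          exact mul_le_mul_of_nonneg_left (hξ1 g ⟨g, hg, rfl⟩) (norm_nonneg _)
      _ = B * (ε / (B + 1)) := by rw [← Finset.sum_mul]
      _ ≤ ε := by
          rw [mul_div_assoc', div_le_iff₀ (by positivity)]
          nlinarith
  have h3 := norm_sub_norm_le (∑ g ∈ T, f g * unitIndicator v (dom (g : G)))
    (∑ g ∈ T, f g * (unitIndicator v (dom (g : G)) * star (conv ξ (invol ξ) g)))
  linarith

end IsotropySums

/-! ### Ideals of `C_c(G)` and their closures. -/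

section FunctionIdeals

variable {G : Type*} [TopologicalSpace G] [ArrowGroupoid G]

theorem conv_zero_left (ψ : G → ℂ) (x : G) : conv (0 : C_c(G, ℂ)) ψ x = 0 :=
  conv_eq_zero_of_left (fun _ _ => rfl) _

theorem conv_neg_left (f : C_c(G, ℂ)) (ψ : G → ℂ) (x : G) :
    conv (-f : C_c(G, ℂ)) ψ x = -conv f ψ x := by
  rw [conv, conv, ← tsum_neg]
  exact tsum_congr fun k => neg_mul _ _

variable [IsEtale G]

/-- A set of functions in `C_c(G)` that is a two-sided ideal for convolution. -/
structure IsConvIdeal (N : Set C_c(G, ℂ)) : Prop where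
  zero_mem : 0 ∈ N
  add_mem : ∀ {f g}, f ∈ N → g ∈ N → f + g ∈ N
  neg_mem : ∀ {f}, f ∈ N → -f ∈ N
  mul_mem_left : ∀ f {g}, g ∈ N → convCc f g ∈ N
  mul_mem_right : ∀ {f} g, f ∈ N → convCc f g ∈ N

/-- The closure in `C_r^*(G)` of an ideal of `C_c(G)`. -/
noncomputable def IsConvIdeal.twoSidedIdeal {N : Set C_c(G, ℂ)} (hN : IsConvIdeal N) :
    TwoSidedIdeal (reducedCStar G) :=
  TwoSidedIdeal.mk' (closure (toReduced '' N))
    (subset_closure ⟨0, hN.zero_mem, toReduced_zero⟩)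
    (fun {x y} hx hy => map_mem_closure₂ continuous_add hx hy (by
      rintro _ ⟨f, hf, rfl⟩ _ ⟨g, hg, rfl⟩
      exact ⟨f + g, hN.add_mem hf hg, toReduced_add f g⟩))
    (fun {x} hx => map_mem_closure continuous_neg hx (by
      rintro _ ⟨f, hf, rfl⟩
      exact ⟨-f, hN.neg_mem hf, toReduced_neg f⟩))
    (fun {x y} hy => map_mem_closure₂ continuous_mul (denseRange_toReduced x) hy (by
      rintro _ ⟨f, rfl⟩ _ ⟨g, hg, rfl⟩
      exact ⟨convCc f g, hN.mul_mem_left f hg, toReduced_convCc f g⟩))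
    (fun {x y} hx => map_mem_closure₂ continuous_mul hx (denseRange_toReduced y) (by
      rintro _ ⟨f, hf, rfl⟩ _ ⟨g, rfl⟩
      exact ⟨convCc f g, hN.mul_mem_right g hf, toReduced_convCc f g⟩))

theorem IsConvIdeal.mem_twoSidedIdeal {N : Set C_c(G, ℂ)} (hN : IsConvIdeal N)
    {a : reducedCStar G} : a ∈ hN.twoSidedIdeal ↔ a ∈ closure (toReduced '' N) := by
  rw [IsConvIdeal.twoSidedIdeal, TwoSidedIdeal.mem_mk']

/-- The closed ideal of `C_r^*(G)` generated by an ideal of `C_c(G)`. -/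
noncomputable def IsConvIdeal.closedIdeal {N : Set C_c(G, ℂ)} (hN : IsConvIdeal N) :
    ClosedIdeal G :=
  ⟨hN.twoSidedIdeal, by
    simp only [hN.mem_twoSidedIdeal]
    exact isClosed_closure⟩

theorem IsConvIdeal.mem_closedIdeal {N : Set C_c(G, ℂ)} (hN : IsConvIdeal N)
    {a : reducedCStar G} : a ∈ hN.closedIdeal.1 ↔ a ∈ closure (toReduced '' N) :=
  hN.mem_twoSidedIdeal

/-- A function on `C_c(G)` that is bounded for the reduced norm and vanishes on `N` vanishes on the
closed ideal generated by `N`. -/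
theorem IsConvIdeal.eq_zero_of_mem {N : Set C_c(G, ℂ)} (hN : IsConvIdeal N) {τ : C_c(G, ℂ) → ℂ}
    {C : ℝ} (hτ : ∀ f g, ‖τ f - τ g‖ ≤ C * ‖toReduced f - toReduced g‖)
    (hτN : ∀ f ∈ N, τ f = 0) {f : C_c(G, ℂ)} (hf : toReduced f ∈ hN.closedIdeal.1) : τ f = 0 := by
  rw [hN.mem_closedIdeal, Metric.mem_closure_iff] at hf
  rw [← norm_le_zero_iff]
  refine le_of_forall_pos_le_add fun ε hε => ?_
  -- No sign is assumed for `C`, and `|C| + 1` also avoids division by zero.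
  obtain ⟨_, ⟨g, hg, rfl⟩, hlt⟩ := hf (ε / (|C| + 1)) (by positivity)
  have h1 := hτ f g
  rw [hτN g hg, sub_zero] at h1
  rw [dist_eq_norm] at hlt
  rw [zero_add]
  calc ‖τ f‖ ≤ |C| * (ε / (|C| + 1)) :=
        h1.trans (mul_le_mul (le_abs_self C) hlt.le (norm_nonneg _) (abs_nonneg _))
    _ ≤ ε := by
        rw [mul_div_assoc', div_le_iff₀ (by positivity)]
        nlinarith

/-- The functions in `C_c(G)` that vanish on `G_D`. -/
def vanishingOn (D : Set (UnitSpace G)) : Set C_c(G, ℂ) := {f | ∀ x, rng x ∈ D → f x = 0}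

/-- The functions in `C_c(G)` that act trivially on the functions on `D`. -/
def actingTrivially (D : Set (UnitSpace G)) : Set C_c(G, ℂ) :=
  {f | ∀ η : UnitSpace G → ℂ, ∀ x, rng x ∈ D → conv f (fun y => η (rng y)) x = 0}

theorem isConvIdeal_vanishingOn {D : Set (UnitSpace G)} (hD : IsInvariant D) :
    IsConvIdeal (vanishingOn D) where
  zero_mem := fun _ _ => rfl
  add_mem := fun hf hg x hx => by
    rw [CompactlySupportedContinuousMap.add_apply, hf x hx, hg x hx, add_zero]
  neg_mem := fun {f} hf x hx => by
    change -f x = 0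
    rw [hf x hx, neg_zero]
  mul_mem_left := fun f g hg x hx =>
    conv_eq_zero_of_right _ fun k hk => hg _ (hD.rng_inv_mul_mem hx hk)
  mul_mem_right := fun {f} g hf x hx =>
    conv_eq_zero_of_left (fun k hk => hf k (by rwa [hk])) _

theorem conv_sub_left (f g : C_c(G, ℂ)) (ψ : G → ℂ) (x : G) :
    conv (f - g : C_c(G, ℂ)) ψ x = conv f ψ x - conv g ψ x := by
  rw [sub_eq_add_neg, conv_add_left, conv_neg_left, ← sub_eq_add_neg]

/-- Convolution by `g` sends a function of the range to another function of the range. Since the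
definition allows every `η`, this gives stability under multiplication on the right. -/
theorem isConvIdeal_actingTrivially {D : Set (UnitSpace G)} (hD : IsInvariant D) :
    IsConvIdeal (actingTrivially D) where
  zero_mem := fun η x _ => conv_zero_left _ x
  add_mem := fun hf hg η x hx => by rw [conv_add_left, hf η x hx, hg η x hx, add_zero]
  neg_mem := fun hf η x hx => by rw [conv_neg_left, hf η x hx, neg_zero]
  mul_mem_left := fun f g hg η x hx => by
    rw [coe_convCc, conv_assoc (fibreFinite f) (fibreFinite g)]
    exact conv_eq_zero_of_right _ fun k hk => hg η _ (hD.rng_inv_mul_mem hx hk)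
  mul_mem_right := fun {f} g hf η x hx => by
    let η' : UnitSpace G → ℂ := fun u => ∑' h : {h : G // rng h = u}, g h * η (dom (h : G))
    have h1 : conv g (fun y => η (rng y)) = fun y => η' (rng y) :=
      funext fun y => conv_comp_rng _ _ _
    rw [coe_convCc, conv_assoc (fibreFinite f) (fibreFinite g), h1]
    exact hf η' x hx

/-- Bumps supported off `D` belong to `vanishingOn D`, so the support contains `Dᶜ`; the hypothesis
`h0` excludes anything more. -/
theorem idealSupport_closedIdeal {N : Set C_c(G, ℂ)} (hN : IsConvIdeal N) {D : Set (UnitSpace G)}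
    (hD : IsClosed D) (hvan : vanishingOn D ⊆ N)
    (h0 : ∀ φ : C_c(UnitSpace G, ℂ), toReduced (unitExt φ) ∈ hN.closedIdeal.1 →
      ∀ u ∈ D, φ u = 0) : idealSupport hN.closedIdeal = Dᶜ := by
  ext u
  rw [mem_idealSupport_iff]
  constructor
  · rintro ⟨φ, hφ, hu⟩ huD
    exact hu (h0 φ hφ u huD)
  · intro hu
    obtain ⟨φ, h1, h2, -⟩ := exists_bump (isCompact_singleton (x := u)) hD.isOpen_compl
      (Set.singleton_subset_iff.2 hu)
    refine ⟨φ, hN.mem_closedIdeal.2 (subset_closure ⟨_, hvan fun x hx => ?_, rfl⟩), ?_⟩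
    · by_contra h
      have h3 := unitExt_support φ x h
      rw [h3, unitExt_arrow] at h
      exact h2 (subset_tsupport _ h) hx
    · rw [h1 u rfl]
      exact one_ne_zero

/-- In an amenable groupoid whose ideals are separated, functions in `C_c(G)` that act trivially on
`D` vanish on `G_D`. -/
theorem eq_zero_of_actingTrivially (hG : Amenable G) (hsep : SeparatesIdeals G)
    {D : Set (UnitSpace G)} (hD : IsClosed D) (hinv : IsInvariant D) {f : C_c(G, ℂ)}
    (hf : f ∈ actingTrivially D) {x : G} (hx : rng x ∈ D) : f x = 0 := by
  have hN₁ := isConvIdeal_vanishingOn hinv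
  have hN₂ := isConvIdeal_actingTrivially hinv
  have hcoef : ∀ (g : C_c(G, ℂ)), toReduced g ∈ hN₁.closedIdeal.1 → ∀ x, rng x ∈ D → g x = 0 :=
    fun g hg x hx => hN₁.eq_zero_of_mem (τ := fun g => g x) (C := 1)
      (fun f g => by
        rw [one_mul, ← toReduced_sub, ← CompactlySupportedContinuousMap.sub_apply,
          ← coef_toReduced]
        exact norm_coef_le _ x) (fun f hf => hf x hx) hg
  have h1 : idealSupport hN₁.closedIdeal = Dᶜ :=
    idealSupport_closedIdeal hN₁ hD le_rfl fun φ hφ u hu => by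
      rw [← unitExt_arrow]
      exact hcoef _ hφ _ (by rwa [rng_unit])
  have h2 : idealSupport hN₂.closedIdeal = Dᶜ := by
    refine idealSupport_closedIdeal hN₂ hD (fun f hf η x hx =>
      conv_eq_zero_of_left (fun k hk => hf k (by rwa [hk])) _) fun φ hφ u hu => ?_
    -- Amenability enters here: the isotropy sum at `u` is bounded for the reduced norm and kills
    -- `actingTrivially D`, hence its closure. On a function of units it is the value at `u`.
    have h3 := hN₂.eq_zero_of_mem (C := 2)
      (τ := fun g => conv g (fun y => unitIndicator u (rng y)) u.arrow)
      (fun f g => by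
        rw [← conv_sub_left, ← toReduced_sub]
        exact norm_isotropy_sum_le hG _ u)
      (fun f hf => hf _ _ (by rwa [rng_unit])) hφ
    have h4 : conv (unitExt φ) (fun y => unitIndicator u (rng y)) u.arrow = φ u := by
      rw [conv_unitExt, rng_unit, unitIndicator, if_pos rfl, mul_one]
    exact h4.symm.trans h3
  have h5 : hN₁.closedIdeal = hN₂.closedIdeal := hsep (h1.trans h2.symm)
  refine hcoef f ?_ x hx
  rw [h5]
  exact hN₂.mem_closedIdeal.2 (subset_closure ⟨f, hf, rfl⟩)

end FunctionIdeals

/-! ### Effectiveness, Baire category, and the converse. -/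

section EffectiveGroupoids

/-- A σ-compact étale groupoid in which every open set of isotropy elements consists of units is
topologically principal. -/
theorem topologicallyPrincipal_of_effective {G : Type*} [TopologicalSpace G] [ArrowGroupoid G]
    [IsEtale G] [SigmaCompactSpace G]
    (h : ∀ W : Set G, IsOpen W → (∀ g ∈ W, dom g = rng g) →
      W ⊆ Set.range (UnitSpace.arrow (G := G))) : TopologicallyPrincipal G := by
  choose S hSo hSb hSx _ using fun x : G =>
    exists_open_bisection (g := x) isOpen_univ (Set.mem_univ x)
  choose C hC hxC hCS using fun x : G => exists_compact_subset (hSo x) (hSx x)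
  obtain ⟨t, ht, htU⟩ := countable_cover_nhds fun x => isOpen_interior.mem_nhds (hxC x)
  have : Countable t := ht
  -- The units with nontrivial isotropy are the union of these countably many sets, one for each
  -- compact piece of a bisection.
  let E : t → Set (UnitSpace G) := fun x =>
    rng '' ((C x \ Set.range (UnitSpace.arrow (G := G))) ∩ {g | dom g = rng g})
  have hE : ∀ x, IsClosed (E x) := fun x =>
    ((((hC x).diff isOpenEmbedding_arrow.isOpen_range).inter_right
      (isClosed_eq continuous_dom continuous_rng)).image continuous_rng).isClosed
  -- Over an interior point of `E x`, every nearby arrow of the bisection `S x` shares its range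
  -- with an isotropy element of `C x`, hence equals it. This is an open set of isotropy containing
  -- a non-unit, against `h`.
  have hEd : ∀ x, Dense (E x)ᶜ := fun x => by
    rw [← interior_eq_empty_iff_dense_compl, Set.eq_empty_iff_forall_notMem]
    intro u hu
    obtain ⟨g, ⟨⟨hgC, hgU⟩, -⟩, rfl⟩ := interior_subset hu
    refine hgU (h (S x ∩ rng ⁻¹' interior (E x))
      ((hSo x).inter (isOpen_interior.preimage continuous_rng)) ?_ ⟨hCS x hgC, hu⟩)
    rintro k ⟨hkS, hkE⟩
    obtain ⟨c, ⟨⟨hcC, -⟩, hc⟩, hck⟩ := interior_subset hkE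
    rw [← (hSb x).rng_inj (hCS x hcC) hkS hck]
    exact hc
  refine (dense_iInter_of_isOpen (fun x => (hE x).isOpen_compl) hEd).mono fun u hu => ?_
  refine Set.eq_singleton_iff_unique_mem.2 ⟨⟨dom_unit u, rng_unit u⟩, ?_⟩
  rintro g ⟨hd, hr⟩
  by_contra hne
  have hg : g ∈ ⋃ x ∈ t, interior (C x) := by rw [htU]; trivial
  obtain ⟨x, hxt, hgx⟩ := Set.mem_iUnion₂.1 hg
  refine Set.mem_iInter.1 hu ⟨x, hxt⟩ ⟨g, ⟨⟨interior_subset hgx, ?_⟩, hd.trans hr.symm⟩, hr⟩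
  rintro ⟨v, rfl⟩
  rw [rng_unit] at hr
  exact hne (by rw [hr])

variable {G : Type*} [TopologicalSpace G] [ArrowGroupoid G] [IsEtale G]

theorem essentiallyPrincipal_of_separatesIdeals [SigmaCompactSpace G] (hG : Amenable G)
    (hsep : SeparatesIdeals G) : EssentiallyPrincipal G := by
  intro D hD hinv
  have : IsEtale (Restr D) := isEtale_restr hinv (Or.inl hD)
  have : SigmaCompactSpace (Restr D) := (isClosedEmbedding_incl hD).sigmaCompactSpace
  refine topologicallyPrincipal_of_effective fun W hW hWiso g hg => ?_
  obtain ⟨W', hW', rfl⟩ := isOpen_induced_iff.1 hW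
  have hiso : ∀ k ∈ W', rng k ∈ D → dom k = rng k := fun k hk hkD => by
    have h1 := hWiso (Restr.of k (hinv.dom_mem hkD) hkD) hk
    apply UnitSpace.arrow_injective
    have h2 := congrArg (fun u : UnitSpace (Restr D) => u.arrow.incl) h1
    simpa only [Restr.incl_dom, Restr.incl_rng, Restr.incl_of] using h2
  by_contra hgU
  have hgU' : g.incl ≠ (rng g.incl).arrow := fun h0 =>
    hgU ⟨rng g, Restr.incl_injective ((Restr.incl_rng g).trans h0.symm)⟩
  obtain ⟨S, hSo, hS, hgS, hSW⟩ := exists_open_bisection hW' hg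
  obtain ⟨f, hf1, hfS, -⟩ := exists_bump (isCompact_singleton (x := g.incl)) hSo
    (Set.singleton_subset_iff.2 hgS)
  have hfS' : ∀ x, f x ≠ 0 → x ∈ S := fun x hx => hfS (subset_tsupport _ hx)
  have hsupp := conv_invol_support hS hfS' hfS'
  -- The first product is pointwise. On functions on `D` both terms multiply by the same function,
  -- since the support of `f` over `D` is isotropy and `f * f^*` sits on the units. At the non-unit
  -- `g` the second term vanishes, so `F` is one there.
  let F : C_c(G, ℂ) := f * star f - convCc f (involCc f)
  have hF : F ∈ actingTrivially D := fun η x hx => by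
    rw [conv_sub_left, conv_comp_rng, coe_convCc, coe_involCc, conv_of_support_units hsupp,
      conv_invol_arrow, ← tsum_mul_right, sub_eq_zero]
    refine tsum_congr fun h => ?_
    rw [CompactlySupportedContinuousMap.mul_apply]
    by_cases hh : f h = 0
    · simp [hh]
    · rw [hiso h (hSW (hfS' h hh)) (by rwa [h.2]), h.2]
      rfl
  have h1 : F g.incl = 1 := by
    have h2 : conv f (invol f) g.incl = 0 := by
      by_contra h0
      exact hgU' (hsupp _ h0)
    rw [CompactlySupportedContinuousMap.sub_apply, coe_convCc, coe_involCc, h2,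
      CompactlySupportedContinuousMap.mul_apply, CompactlySupportedContinuousMap.star_apply,
      hf1 _ rfl]
    simp
  have h2 := eq_zero_of_actingTrivially hG hsep hD hinv hF (x := g.incl) g.2.2
  rw [h1] at h2
  exact one_ne_zero h2

end EffectiveGroupoids

end ArrowGroupoid

theorem mainTheorem9 {G : Type*} [TopologicalSpace G] [ArrowGroupoid G]
    [ArrowGroupoid.IsEtale G] :
    (ArrowGroupoid.EssentiallyPrincipal G → ArrowGroupoid.InnerExact G →
      ArrowGroupoid.SeparatesIdeals G) ∧
    (ArrowGroupoid.Amenable G →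
      (ArrowGroupoid.EssentiallyPrincipal G → ArrowGroupoid.SeparatesIdeals G) ∧
      (SigmaCompactSpace G →
        ArrowGroupoid.SeparatesIdeals G → ArrowGroupoid.EssentiallyPrincipal G)) := by
  refine ⟨fun h1 h2 => ?_, fun h => ⟨fun h1 => ?_, fun _ h1 => ?_⟩⟩
  · exact ArrowGroupoid.separatesIdeals_of_vanishingApproximation h1
      (ArrowGroupoid.vanishingApproximation_of_innerExact h2)
  · exact ArrowGroupoid.separatesIdeals_of_vanishingApproximation h1
      (ArrowGroupoid.vanishingApproximation_of_amenable h)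
  · exact ArrowGroupoid.essentiallyPrincipal_of_separatesIdeals h h1
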